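/- **Proposition (Traveling wave equations, spatially periodic version).** Let $\rho_1,\rho_2\ge 0$ with $\rho_1+\rho_2>0$, let $A=\frac{\rho_1-\rho_2}{\rho_1+\rho_2}$ be the Atwood number, and let $\tau>0$, $M>0$, $g\in\mathbf R$. *The evolution equations.* For an interface $S(t)=\{z(\alpha,t):\alpha\in\mathbf R\}\subset\mathbf C$, where $z(\cdot,t)$ is an injective regular $C^1$ parametrization, and a real vortex sheet-strength $\gamma(\alpha,t)$, put $T=z_\alpha/|z_\alpha|$, $N=iT$, write $z_\alpha=|z_\alpha|e^{i\theta}$ with $\theta$ real, $y=\operatorname{Im}z$, and $$W^*(\alpha,t)=\frac1{2\pi i}\,\mathrm{PV}\!\int_{\mathbf R}\frac{\gamma(\alpha',t)}{z(\alpha,t)-z(\alpha',t)}\,d\alpha',\qquad u(w,t)=\Big[\frac1{2\pi i}\int_{\mathbf R}\frac{\gamma(\alpha',t)}{w-z(\alpha',t)}\,d\alpha'\Big]^*\quad(w\notin S(t)),$$ where $^*$ on the bracket is complex conjugation, $\mathrm{PV}\int_{\mathbf R}$ is the limit of the integrals over $\varepsilon<|\alpha'-\alpha|<R$ as $\varepsilon\to0^+$,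 $R\to\infty$, and the second integral is the limit of the integrals over $[-R,R]$. The vortex sheet equations for $(z,\gamma)$ are: for some real function $V(\alpha,t)$, $$z_t=\operatorname{Re}(W^*N)\,N+V\,T,\tag{1}$$ $$\gamma_t=\tau\frac{\theta_{\alpha\alpha}}{|z_\alpha|}+\frac{((V-\operatorname{Re}(W^*T))\gamma)_\alpha}{|z_\alpha|}-2A\Big(\frac{\operatorname{Re}(W^*_tT)}{|z_\alpha|}+\frac18\frac{(\gamma^2)_\alpha}{|z_\alpha|^2}+g\,y_\alpha-(V-\operatorname{Re}(W^*T))\operatorname{Re}(W^*_\alpha T)\Big).\tag{2}$$ A solution is understood in the classical sense: the integrals above converge, $\theta(\cdot,t)$ is $C^2$, $\gamma(\cdot,t)$ is $C^1$, the other derivatives that occur exist, and the equations hold for all $(\alpha,t)$. It is a *traveling wave solution with speed $c$* if $S(t)=S(0)+ct$ for all $t$ and $u(w,t)=u(w-ct,0)$ for all $t$ and $w\notin S(t)$. It is *spatially periodic with period $M$* if $S(t)=S(t)+M$ and $u(w+M,t)=u(w,t)$ for all $t$ and $w\notin S(t)$. *The traveling wave equations.* Let $\theta\in C^2(\mathbf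 R)$ and $\gamma\in C^1(\mathbf R)$ be real-valued and $2\pi$-periodic, and let $c\in\mathbf R$, $c\ne0$. Write $\overline f=\frac1{2\pi}\int_0^{2\pi}f$, assume $\overline{\cos\theta}>0$, and set $$\widetilde Z[\theta](\alpha)=\frac{M}{2\pi\overline{\cos\theta}}\Big\{\int_0^\alpha e^{i\theta(\beta)}\,d\beta-i\alpha\,\overline{\sin\theta}\Big\},\qquad \widetilde T[\theta]=\frac{\partial_\alpha\widetilde Z[\theta]}{|\partial_\alpha\widetilde Z[\theta]|},\qquad\widetilde N[\theta]=i\,\widetilde T[\theta].$$ Assume that this curve does not intersect itself, that is, $\widetilde Z[\theta]$ is injective on $\mathbf R$. Let $$B[w]\gamma(\alpha)=\frac1{2\pi i}\,\mathrm{PV}\!\int_{\mathbf R}\frac{\gamma(\alpha')}{w(\alpha)-w(\alpha')}\,d\alpha',$$ and, with $X=c\cos\theta-\operatorname{Re}(B[\widetilde Z[\theta]]\gamma\,\widetilde T[\theta])$, $$\widetilde\Phi(\theta,\gamma;c)=\frac1\tau\partial_\alpha(X\gamma)-\frac A\tau\Big(\frac{\pi\overline{\cos\theta}}{2M}\,\partial_\alpha(\gamma^2)+\frac{gM^2}{2\pi^2\,\overline{\cos\theta}^{\,2}}\,(\sin\theta-\overline{\sin\theta})+\frac{M}{2\pi\overline{\cos\theta}}\,\partial_\alpha(X^2)\Big).$$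 *Claim.* If $$\operatorname{Re}\big(B[\widetilde Z[\theta]]\gamma\,\widetilde N[\theta]\big)+c\sin\theta=0\qquad\text{and}\qquad\theta_{\alpha\alpha}+\widetilde\Phi(\theta,\gamma;c)=0$$ hold on $\mathbf R$, then $z(\alpha,t)=\widetilde Z[\theta](\alpha)+ct$, $\gamma(\alpha,t)=\gamma(\alpha)$ is a spatially periodic traveling wave solution of (1)-(2), with speed $c$ and period $M$. -/

import Mathlib

open Filter Topology MeasureTheory

noncomputable section

namespace VortexSheet

/-- The average over one period, `(1 / 2π) ∫₀^{2π} f`. -/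
def mean (f : ℝ → ℝ) : ℝ := (1 / (2 * Real.pi)) * ∫ a in (0 : ℝ)..(2 * Real.pi), f a

/-- The Atwood number. -/
def atwood (ρ₁ ρ₂ : ℝ) : ℝ := (ρ₁ - ρ₂) / (ρ₁ + ρ₂)

/-! ### Principal values and the Birkhoff-Rott integral -/

/-- The integral of `f` over `ε < |x - a| < R`. -/
def truncatedIntegral (f : ℝ → ℂ) (a : ℝ) (p : ℝ × ℝ) : ℂ :=
  ∫ x in {x : ℝ | p.1 < |x - a| ∧ |x - a| < p.2}, f x

/-- `PV ∫_ℝ f = l`, for an integrand that is singular at `a` and only conditionally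
integrable at infinity: `ε → 0⁺` and `R → ∞` independently of each other. -/
def HasPV (f : ℝ → ℂ) (a : ℝ) (l : ℂ) : Prop :=
  Tendsto (truncatedIntegral f a) (𝓝[>] (0 : ℝ) ×ˢ atTop) (𝓝 l)

/-- The value of `PV ∫_ℝ f` with singularity at `a` (meaningful when it exists). -/
def pv (f : ℝ → ℂ) (a : ℝ) : ℂ :=
  limUnder (𝓝[>] (0 : ℝ) ×ˢ atTop) (truncatedIntegral f a)

/-- The integrand `a' ↦ γ(a') / (w(a) - w(a'))`. -/
def kernel (w : ℝ → ℂ) (γ : ℝ → ℝ) (a : ℝ) : ℝ → ℂ :=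
  fun a' => (γ a' : ℂ) / (w a - w a')

/-- The Birkhoff-Rott integral `B[w]γ`. -/
def birkhoffRott (w : ℝ → ℂ) (γ : ℝ → ℝ) (a : ℝ) : ℂ :=
  (1 / (2 * (Real.pi : ℂ) * Complex.I)) * pv (kernel w γ a) a

/-- The unit tangent `w_α / |w_α|` of a parametrized curve. -/
def unitTangent (w : ℝ → ℂ) (a : ℝ) : ℂ := deriv w a / (‖deriv w a‖ : ℂ)

/-- The unit upward normal `i w_α / |w_α|` of a parametrized curve. -/
def unitNormal (w : ℝ → ℂ) (a : ℝ) : ℂ := Complex.I * unitTangent w a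

/-! ### The evolution equations.
Below `z a t` is the moving interface and `γ a t` the unnormalized vortex sheet-strength. -/

/-- The interface at time `t`, as a subset of the plane. -/
def interface (z : ℝ → ℝ → ℂ) (t : ℝ) : Set ℂ := Set.range (fun a => z a t)

/-- `W^*(α, t)`, the Birkhoff-Rott integral of `z(·, t)` and `γ(·, t)`. -/
def Wstar (z : ℝ → ℝ → ℂ) (γ : ℝ → ℝ → ℝ) (a t : ℝ) : ℂ :=
  birkhoffRott (fun b => z b t) (fun b => γ b t) a

/-- The truncation to `[-R, R]` of the integral that gives the bulk velocity at `w`. -/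
def velocityIntegral (z : ℝ → ℝ → ℂ) (γ : ℝ → ℝ → ℝ) (w : ℂ) (t R : ℝ) : ℂ :=
  ∫ a in (-R)..R, (γ a t : ℂ) / (w - z a t)

/-- The fluid velocity `u(w, t)` at a point `w` off the interface. The integral over the line
converges only conditionally at infinity and is the limit of the integrals over `[-R, R]`. -/
def velocity (z : ℝ → ℝ → ℂ) (γ : ℝ → ℝ → ℝ) (w : ℂ) (t : ℝ) : ℂ :=
  (starRingEnd ℂ) ((1 / (2 * (Real.pi : ℂ) * Complex.I)) *
    limUnder atTop (velocityIntegral z γ w t))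

/-- `(z, γ)` is a classical solution of the vortex sheet equations, with tangent angle `θ` and
tangential velocity `V`: all integrals and derivatives in the equations exist, and the
equations hold at all `(α, t)`. -/
structure SolvesWith (τ A g : ℝ) (z : ℝ → ℝ → ℂ) (γ θ V : ℝ → ℝ → ℝ) : Prop where
  z_space : ∀ t, ContDiff ℝ 1 (fun a => z a t)
  z_time : ∀ a, Differentiable ℝ (fun t => z a t)
  z_regular : ∀ a t, deriv (fun b => z b t) a ≠ 0
  z_injective : ∀ t, Function.Injective (fun a => z a t)
  γ_space : ∀ t, ContDiff ℝ 1 (fun a => γ a t)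
  γ_time : ∀ a, Differentiable ℝ (fun t => γ a t)
  θ_space : ∀ t, ContDiff ℝ 2 (fun a => θ a t)
  V_space : ∀ t, Differentiable ℝ (fun a => V a t)
  W_exists : ∀ a t, ∃ l, HasPV (kernel (fun b => z b t) (fun b => γ b t) a) a l
  W_space : ∀ t, Differentiable ℝ (fun a => Wstar z γ a t)
  W_time : ∀ a, Differentiable ℝ (fun t => Wstar z γ a t)
  u_exists : ∀ t, ∀ w ∉ interface z t, ∃ l, Tendsto (velocityIntegral z γ w t) atTop (𝓝 l)
  /-- `z_α = |z_α| e^{iθ}`. -/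
  tangent_angle : ∀ a t, deriv (fun b => z b t) a =
    (‖deriv (fun b => z b t) a‖ : ℂ) * Complex.exp (Complex.I * (θ a t : ℂ))
  /-- `z_t = U N + V T` with `U = Re (W^* N)`. -/
  z_eqn : ∀ a t,
    let T := unitTangent (fun b => z b t) a
    let N := unitNormal (fun b => z b t) a
    let U := (Wstar z γ a t * N).re
    deriv (fun s => z a s) t = (U : ℂ) * N + (V a t : ℂ) * T
  /-- The evolution equation of the vortex sheet-strength. -/
  γ_eqn : ∀ a t,
    let T : ℝ → ℂ := unitTangent (fun b => z b t)
    let s : ℝ := ‖deriv (fun b => z b t) a‖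
    deriv (fun r => γ a r) t =
      τ * deriv (deriv (fun b => θ b t)) a / s
      + deriv (fun b => (V b t - (Wstar z γ b t * T b).re) * γ b t) a / s
      - 2 * A * ((deriv (fun r => Wstar z γ a r) t * T a).re / s
          + (1 / 8) * (deriv (fun b => γ b t ^ 2) a / s ^ 2)
          + g * deriv (fun b => (z b t).im) a
          - (V a t - (Wstar z γ a t * T a).re)
              * (deriv (fun b => Wstar z γ b t) a * T a).re)

/-- `(z, γ)` solves the vortex sheet equations, for some choice of the tangent angle and of the
tangential velocity. -/
def IsSolution (τ A g : ℝ) (z : ℝ → ℝ → ℂ) (γ : ℝ → ℝ → ℝ) : Prop :=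
  ∃ θ V : ℝ → ℝ → ℝ, SolvesWith τ A g z γ θ V

/-- `(z, γ)` is a traveling wave solution with speed `c`: a solution for which
`S(t) = S(0) + ct` and `u(w, t) = u(w - ct, 0)` off the interface. -/
def IsTravelingWave (τ A g c : ℝ) (z : ℝ → ℝ → ℂ) (γ : ℝ → ℝ → ℝ) : Prop :=
  IsSolution τ A g z γ ∧
  (∀ t : ℝ, interface z t = {w : ℂ | w - ((c * t : ℝ) : ℂ) ∈ interface z 0}) ∧
  (∀ t : ℝ, ∀ w ∉ interface z t,
    velocity z γ w t = velocity z γ (w - ((c * t : ℝ) : ℂ)) 0)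

/-- Horizontal spatial periodicity with period `M`: `S(t) = S(t) + M` and
`u(w + M, t) = u(w, t)` off the interface. -/
def IsSpatiallyPeriodic (M : ℝ) (z : ℝ → ℝ → ℂ) (γ : ℝ → ℝ → ℝ) : Prop :=
  (∀ t : ℝ, interface z t = {w : ℂ | w - (M : ℂ) ∈ interface z t}) ∧
  (∀ t : ℝ, ∀ w ∉ interface z t, velocity z γ (w + (M : ℂ)) t = velocity z γ w t)

/-! ### The periodic traveling wave equations -/

/-- The renormalized curve `Z̃[θ]` of period `M` built from the tangent angle `θ`. -/
def renormCurve (M : ℝ) (θ : ℝ → ℝ) (a : ℝ) : ℂ :=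
  ((M / (2 * Real.pi * mean (fun b => Real.cos (θ b))) : ℝ) : ℂ) *
    ((∫ b in (0 : ℝ)..a, Complex.exp (Complex.I * (θ b : ℂ)))
      - Complex.I * (a : ℂ) * (mean (fun b => Real.sin (θ b)) : ℂ))

/-- `c cos θ - Re (B[Z̃[θ]]γ T̃[θ])`. -/
def relativeTangential (M : ℝ) (θ γ : ℝ → ℝ) (c a : ℝ) : ℝ :=
  c * Real.cos (θ a)
    - (birkhoffRott (renormCurve M θ) γ a * unitTangent (renormCurve M θ) a).re

/-- The nonlinear operator `Φ̃(θ, γ; c)`. The gravity term has the coefficient `2 g σ²` with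
`σ = M / (2π mean(cos θ))`, which is what `g y_α` with `y_α = σ sin θ` contributes. -/
def phiTilde (τ A g M : ℝ) (θ γ : ℝ → ℝ) (c a : ℝ) : ℝ :=
  let m := mean (fun b => Real.cos (θ b))
  (1 / τ) * deriv (fun b => relativeTangential M θ γ c b * γ b) a
  - (A / τ) * (Real.pi * m / (2 * M) * deriv (fun b => γ b ^ 2) a
      + g * M ^ 2 / (2 * Real.pi ^ 2 * m ^ 2)
          * (Real.sin (θ a) - mean (fun b => Real.sin (θ b)))
      + M / (2 * Real.pi * m) * deriv (fun b => relativeTangential M θ γ c b ^ 2) a)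

end VortexSheet

end

/-!
The translated curve solves the kinematic equation with tangential velocity `V = c cos θ`, and the
dynamic equation then is the renormalized one up to a factor, provided that (1) the mean of `sin θ`
vanishes, so that `θ` is the tangent angle of the renormalized curve `Z`, and (2) the
Birkhoff-Rott integral `W*` of `Z` is differentiable, although `γ` is only `C¹`.

*Reduction to one period.* Scale `Z` to a curve `w` with `w(a + 2π) = w(a) + π`. Summing
`1 / (u - w)` over the periods gives a cotangent (`IsPeriodicCurve.tendsto_integral_symmQuotient`),
so the principal value over the line is `-1 / w'(a)` times the absolutely convergent integral over
`(0, π)` of `γ(a + x) k(a, x) + γ(a - x) k(a, -x)` with `k(a, x) = w'(a) cot (w(a + x) - w(a))`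
(`IsPeriodicCurve.hasPV_kernel`). Here `k(a, x) - 1 / x` and the derivative of `k` in `a` are
bounded, because `w'` has a Lipschitz derivative and the curve meets neither itself nor its
translates.

*Mean slope.* The real part of this integral is the flux through the curve, up to a factor, and its
integral over a period vanishes: after an exchange of integrals and a shift, the kernel becomes a
derivative of `log |sin|` (`IsPeriodicCurve.integral_re_integral_symmKernel`). With the kinematic
equation the integral of `sin θ |e^{iθ} - it|` is zero, where `t = mean (sin θ)`, and the concavity
estimate `chord_le` forces `t = 0` (`mean_sin_eq_zero`).

*Differentiability.* The kinematic equation prescribes the normal component `-c sin θ` of the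
velocity. The tangential component is the integral with the imaginary part of `k`, which is bounded
since the singular part `1 / x` is real, so it may be differentiated under the integral sign
(`IsPeriodicCurve.differentiable_im_integral_symmKernel`). Hence `W* e^{iθ}` is differentiable, and
`X = c cos θ - Re (W* T)` satisfies `X' = -Re (W*_α T)`
(`differentiable_and_hasDerivAt_of_mul_exp_eq`), which turns the last term of the dynamic equation
into half the derivative of `X²`.
-/

noncomputable section

namespace VortexSheet

/-! ### Elementary estimates -/

theorem exists_norm_le_of_periodic {E : Type*} [NormedAddCommGroup E] {f : ℝ → E} {p : ℝ}
    (hf : Continuous f) (hper : Function.Periodic f p) (hp : 0 < p) :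
    ∃ C, 0 < C ∧ ∀ x, ‖f x‖ ≤ C := by
  obtain ⟨C, hC⟩ := (isCompact_Icc (a := (0 : ℝ)) (b := p)).exists_bound_of_continuousOn
    hf.continuousOn
  refine ⟨max C 1, by positivity, fun x => ?_⟩
  obtain ⟨y, hy, hxy⟩ := hper.exists_mem_Ico₀ hp x
  rw [hxy]
  exact (hC y ⟨hy.1, hy.2.le⟩).trans (le_max_left _ _)

theorem norm_sub_le_of_hasDerivAt {E : Type*} [NormedAddCommGroup E] [NormedSpace ℝ E]
    {f f' : ℝ → E} {C : ℝ} (hf : ∀ y, HasDerivAt f (f' y) y)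
    (hC : ∀ y, ‖f' y‖ ≤ C) (a b : ℝ) : ‖f a - f b‖ ≤ C * |a - b| := by
  have := Convex.norm_image_sub_le_of_norm_hasDerivWithin_le (f := f) (f' := f') (s := Set.univ)
    (fun y _ => (hf y).hasDerivWithinAt) (fun y _ => hC y) convex_univ (Set.mem_univ b)
    (Set.mem_univ a)
  simpa using this

/-- Taylor's formula of first order with quadratic remainder, for a Lipschitz derivative. -/
theorem norm_taylor_le {f f' : ℝ → ℂ} {K : ℝ} (hf : ∀ y, HasDerivAt f (f' y) y)
    (hK : ∀ a b, ‖f' a - f' b‖ ≤ K * |a - b|) (a x : ℝ) :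
    ‖f (a + x) - f a - x * f' a‖ ≤ K * x ^ 2 := by
  have hK0 : 0 ≤ K := by simpa using (norm_nonneg _).trans (hK 1 0)
  have h := Convex.norm_image_sub_le_of_norm_hasDerivWithin_le (f := fun y => f y - y * f' a)
    (f' := fun y => f' y - f' a) (s := Set.uIcc a (a + x)) (C := K * |x|) (x := a) (y := a + x)
    (fun y _ => by
      have := (hf y).fun_sub ((Complex.ofRealCLM.hasDerivAt (x := y)).mul_const (f' a))
      simpa using this.hasDerivWithinAt)
    (fun y hy => (hK y a).trans (mul_le_mul_of_nonneg_left
      (by simpa using Set.abs_sub_left_of_mem_uIcc hy) hK0))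
    (convex_uIcc a (a + x)) Set.left_mem_uIcc Set.right_mem_uIcc
  have e : f (a + x) - ((a + x : ℝ) : ℂ) * f' a - (f a - a * f' a)
      = f (a + x) - f a - x * f' a := by
    push_cast; ring
  simp only [e] at h
  refine h.trans (le_of_eq ?_)
  rw [add_sub_cancel_left, Real.norm_eq_abs, mul_assoc, abs_mul_abs_self, sq]

theorem exists_norm_cos_sub_one_le (R : ℝ) :
    ∃ C, 0 ≤ C ∧ ∀ z : ℂ, ‖z‖ ≤ R →
      ‖Complex.cos z - 1‖ ≤ C * ‖z‖ ∧ ‖Complex.sin z - z‖ ≤ C * ‖z‖ ^ 2 := by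
  obtain ⟨C, hC⟩ := (isCompact_closedBall (0 : ℂ) R).exists_bound_of_continuousOn
    (f := Complex.sin) Complex.continuous_sin.continuousOn
  have hcos : ∀ z : ℂ, ‖z‖ ≤ R → ‖Complex.cos z - 1‖ ≤ max C 0 * ‖z‖ := fun z hz => by
    have := Convex.norm_image_sub_le_of_norm_hasDerivWithin_le (f := Complex.cos)
      (f' := fun z => -Complex.sin z) (s := Metric.closedBall (0 : ℂ) R) (C := max C 0)
      (fun y _ => (Complex.hasDerivAt_cos y).hasDerivWithinAt)
      (fun y hy => by rw [norm_neg]; exact (hC y hy).trans (le_max_left _ _))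
      (convex_closedBall 0 R) (x := 0) (y := z)
      (by simpa using (norm_nonneg z).trans hz) (by simpa using hz)
    simpa using this
  refine ⟨max C 0, le_max_right _ _, fun z hz => ⟨hcos z hz, ?_⟩⟩
  have := Convex.norm_image_sub_le_of_norm_hasDerivWithin_le (f := fun z => Complex.sin z - z)
    (f' := fun z => Complex.cos z - 1) (s := Metric.closedBall (0 : ℂ) ‖z‖) (C := max C 0 * ‖z‖)
    (fun y _ => ((Complex.hasDerivAt_sin y).sub (hasDerivAt_id y)).hasDerivWithinAt)
    (fun y hy => by
      have hy' : ‖y‖ ≤ ‖z‖ := by simpa using hy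
      exact (hcos y (hy'.trans hz)).trans (by gcongr))
    (convex_closedBall 0 _) (x := 0) (y := z) (by simp) (by simp)
  simpa [sq, mul_assoc] using this

/-- A positive function that is periodic in `a` and bounded below by `m |x|` for small `x` is
bounded below by a multiple of `|x|` on the whole strip `|x| ≤ X`, by compactness. -/
theorem exists_linear_lower_bound {f : ℝ → ℝ → ℝ} {p X r m : ℝ} (hp : 0 < p)
    (hf : Continuous (Function.uncurry f)) (hper : ∀ a x, f (a + p) x = f a x)
    (hpos : ∀ a x, x ≠ 0 → |x| ≤ X → 0 < f a x) (hr : 0 < r) (hm : 0 < m)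
    (hloc : ∀ a x, |x| ≤ r → m * |x| ≤ f a x) :
    ∃ δ, 0 < δ ∧ ∀ a x, |x| ≤ X → δ * |x| ≤ f a x := by
  set S : Set (ℝ × ℝ) := Set.Icc 0 p ×ˢ {x | r ≤ |x| ∧ |x| ≤ X} with hS
  have hSc : IsCompact S := by
    refine isCompact_Icc.prod (Metric.isCompact_of_isClosed_isBounded ?_ ?_)
    · exact (isClosed_le continuous_const continuous_abs).inter
        (isClosed_le continuous_abs continuous_const)
    · refine (Metric.isBounded_closedBall (x := (0 : ℝ)) (r := X)).subset fun x hx => ?_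
      simpa using hx.2
  -- away from `x = 0` the minimum of `f / |x|` over one period is attained
  have key : ∃ δ, 0 < δ ∧ ∀ q ∈ S, δ * |q.2| ≤ f q.1 q.2 := by
    rcases S.eq_empty_or_nonempty with he | hne
    · exact ⟨1, one_pos, fun q hq => by simp [he] at hq⟩
    · have hx0 : ∀ q ∈ S, 0 < |q.2| := fun q hq => hr.trans_le hq.2.1
      have hcont : ContinuousOn (fun q : ℝ × ℝ => f q.1 q.2 / |q.2|) S :=
        hf.continuousOn.div (by fun_prop) fun q hq => (hx0 q hq).ne'
      obtain ⟨q₀, hq₀, hmin⟩ := hSc.exists_isMinOn hne hcont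
      refine ⟨f q₀.1 q₀.2 / |q₀.2|, div_pos (hpos _ _ (abs_pos.1 (hx0 _ hq₀)) hq₀.2.2)
        (hx0 _ hq₀), fun q hq => ?_⟩
      rw [← le_div_iff₀ (hx0 q hq)]
      exact hmin hq
  obtain ⟨δ, hδ, hb⟩ := key
  refine ⟨min δ m, lt_min hδ hm, fun a x hx => ?_⟩
  rcases le_or_gt |x| r with h | h
  · exact (mul_le_mul_of_nonneg_right (min_le_right _ _) (abs_nonneg _)).trans (hloc a x h)
  · obtain ⟨y, hy, hxy⟩ := Function.Periodic.exists_mem_Ico₀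
      (f := fun a => f a x) (fun a => hper a x) hp a
    have hxy : f a x = f y x := hxy
    rw [hxy]
    exact (mul_le_mul_of_nonneg_right (min_le_left _ _) (abs_nonneg _)).trans
      (hb (y, x) ⟨⟨hy.1, hy.2.le⟩, h.le, hx⟩)

/-! ### Regular curves with period `π` -/

/-- `w` is an injective regular curve in the plane with `w (a + 2π) = w a + π`, with first and
second derivatives `w'` and `w''`, the second one being Lipschitz continuous. The period is
normalized to the period of the cotangent. -/
structure IsPeriodicCurve (w w' w'' : ℝ → ℂ) : Prop where
  hasDerivAt : ∀ a, HasDerivAt w (w' a) a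
  hasDerivAt' : ∀ a, HasDerivAt w' (w'' a) a
  lipschitz : ∃ K, ∀ a b, ‖w'' a - w'' b‖ ≤ K * |a - b|
  translate : ∀ a, w (a + 2 * Real.pi) = w a + Real.pi
  regular : ∀ a, w' a ≠ 0
  injective : Function.Injective w

/-- The increment `w (a + x) - w a` of a curve. -/
def increment (w : ℝ → ℂ) (a x : ℝ) : ℂ := w (a + x) - w a

/-- The periodized kernel `w'(a) cot (w (a + x) - w a)`, which behaves like `1 / x` near `x = 0`. -/
def cotKernel (w w' : ℝ → ℂ) (a x : ℝ) : ℂ := w' a * Complex.cot (increment w a x)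

/-- The derivative of `cotKernel w w' a x` in `a`, for fixed `x`. -/
def cotKernelDeriv (w w' w'' : ℝ → ℂ) (a x : ℝ) : ℂ :=
  (w'' a * (Complex.sin (increment w a x) * Complex.cos (increment w a x))
    - w' a * increment w' a x) / Complex.sin (increment w a x) ^ 2

namespace IsPeriodicCurve

variable {w w' w'' : ℝ → ℂ}

theorem continuous (h : IsPeriodicCurve w w' w'') : Continuous w :=
  continuous_iff_continuousAt.2 fun a => (h.hasDerivAt a).continuousAt

theorem continuous' (h : IsPeriodicCurve w w' w'') : Continuous w' :=
  continuous_iff_continuousAt.2 fun a => (h.hasDerivAt' a).continuousAt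

theorem continuous'' (h : IsPeriodicCurve w w' w'') : Continuous w'' := by
  obtain ⟨K, hK⟩ := h.lipschitz
  refine (LipschitzWith.of_dist_le_mul (K := K.toNNReal) fun a b => ?_).continuous
  rw [dist_eq_norm, Real.dist_eq]
  exact (hK a b).trans (by gcongr; exact Real.le_coe_toNNReal K)

theorem periodic' (h : IsPeriodicCurve w w' w'') : Function.Periodic w' (2 * Real.pi) := fun a => by
  have h1 := (h.hasDerivAt (a + 2 * Real.pi)).comp_add_const a (2 * Real.pi)
  simp only [h.translate] at h1
  exact h1.unique ((h.hasDerivAt a).add_const _)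

theorem periodic'' (h : IsPeriodicCurve w w' w'') :
    Function.Periodic w'' (2 * Real.pi) := fun a => by
  have h1 := (h.hasDerivAt' (a + 2 * Real.pi)).comp_add_const a (2 * Real.pi)
  simp only [h.periodic' _] at h1
  exact h1.unique (h.hasDerivAt' a)

theorem continuous_increment (h : IsPeriodicCurve w w' w'') :
    Continuous (Function.uncurry (increment w)) := by
  have := h.continuous
  unfold increment Function.uncurry
  fun_prop

theorem increment_periodic (h : IsPeriodicCurve w w' w'') (a x : ℝ) :
    increment w (a + 2 * Real.pi) x = increment w a x := by
  rw [increment, increment, add_right_comm, h.translate, h.translate, add_sub_add_right_eq_sub]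

theorem translate_nat (h : IsPeriodicCurve w w' w'') (a : ℝ) (n : ℕ) :
    w (a + n * (2 * Real.pi)) = w a + n * Real.pi := by
  induction n with
  | zero => simp
  | succ n ih =>
    have : a + (n + 1 : ℕ) * (2 * Real.pi) = a + n * (2 * Real.pi) + 2 * Real.pi := by
      push_cast; ring
    rw [this, h.translate, ih]; push_cast; ring

theorem translate_int (h : IsPeriodicCurve w w' w'') (a : ℝ) (n : ℤ) :
    w (a + n * (2 * Real.pi)) = w a + n * Real.pi := by
  obtain ⟨m, rfl | rfl⟩ := n.eq_nat_or_neg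
  · simpa using h.translate_nat a m
  · have := h.translate_nat (a + -m * (2 * Real.pi)) m
    have e : a + -m * (2 * Real.pi) + m * (2 * Real.pi) = a := by ring
    rw [e] at this
    push_cast
    rw [this]; ring

/-- By injectivity on the whole line, the curve does not meet its own translates by multiples
of `π`. -/
theorem sin_increment_ne_zero (h : IsPeriodicCurve w w' w'') {a x : ℝ} (hx : x ≠ 0)
    (hxπ : |x| ≤ Real.pi) : Complex.sin (increment w a x) ≠ 0 := by
  rw [Complex.sin_ne_zero_iff]
  intro k hk
  have h1 : w (a + x) = w (a + k * (2 * Real.pi)) := by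
    rw [h.translate_int, ← hk, increment]; ring
  have h2 : x = k * (2 * Real.pi) := by simpa using h.injective h1
  have hk0 : k ≠ 0 := fun h0 => hx (by simp [h2, h0])
  have h3 : (1 : ℝ) ≤ |(k : ℝ)| := by exact_mod_cast Int.one_le_abs hk0
  rw [h2, abs_mul, abs_of_pos Real.two_pi_pos] at hxπ
  nlinarith [Real.pi_pos]

/-- Common bounds for the derivatives of the curve and for its Taylor remainders. -/
theorem exists_bounds (h : IsPeriodicCurve w w' w'') :
    ∃ C, 0 < C ∧ ∀ a, ‖w' a‖ ≤ C ∧ ‖w'' a‖ ≤ C ∧ ∀ x, ‖increment w a x‖ ≤ C * |x| ∧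
      ‖increment w a x - x * w' a‖ ≤ C * x ^ 2 ∧
      ‖increment w' a x - x * w'' a‖ ≤ C * x ^ 2 := by
  obtain ⟨C1, hC1, h1⟩ := exists_norm_le_of_periodic h.continuous' h.periodic' Real.two_pi_pos
  obtain ⟨C2, hC2, h2⟩ := exists_norm_le_of_periodic h.continuous'' h.periodic'' Real.two_pi_pos
  obtain ⟨K, hK⟩ := h.lipschitz
  refine ⟨max (max C1 C2) K, by positivity, fun a => ⟨(h1 a).trans (by simp),
    (h2 a).trans (by simp), fun x => ⟨?_, ?_, ?_⟩⟩⟩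
  · have := norm_sub_le_of_hasDerivAt h.hasDerivAt h1 (a + x) a
    rw [add_sub_cancel_left] at this
    exact this.trans (by gcongr; simp)
  · exact (norm_taylor_le h.hasDerivAt (norm_sub_le_of_hasDerivAt h.hasDerivAt' h2) a x).trans
      (by gcongr; simp)
  · exact (norm_taylor_le h.hasDerivAt' hK a x).trans (by gcongr; simp)

theorem exists_le_norm_deriv (h : IsPeriodicCurve w w' w'') : ∃ m, 0 < m ∧ ∀ a, m ≤ ‖w' a‖ := by
  obtain ⟨C, hC, h1⟩ := exists_norm_le_of_periodic (f := fun a => (w' a)⁻¹)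
    (h.continuous'.inv₀ h.regular) (fun a => by simp only [h.periodic' a]) Real.two_pi_pos
  refine ⟨C⁻¹, by positivity, fun a => ?_⟩
  have := h1 a
  rw [norm_inv] at this
  exact inv_le_of_inv_le₀ (norm_pos_iff.2 (h.regular a)) this

/-- Sine and cosine of the increment agree with their expansions at the origin up to errors
`O(x²)` and `O(x)`. -/
theorem exists_trig_bounds (h : IsPeriodicCurve w w' w'') :
    ∃ C, 0 ≤ C ∧ ∀ a x, |x| ≤ Real.pi → ‖Complex.cos (increment w a x) - 1‖ ≤ C * |x| ∧
      ‖Complex.sin (increment w a x) - increment w a x‖ ≤ C * x ^ 2 ∧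
      ‖Complex.cos (increment w a x)‖ ≤ C := by
  obtain ⟨B, hB, hb⟩ := h.exists_bounds
  obtain ⟨C, hC, hc⟩ := exists_norm_cos_sub_one_le (B * Real.pi)
  have key : ∀ a x, |x| ≤ Real.pi → ‖Complex.cos (increment w a x) - 1‖ ≤ C * B * |x| ∧
      ‖Complex.sin (increment w a x) - increment w a x‖ ≤ C * B ^ 2 * x ^ 2 := fun a x hx => by
    have h1 := ((hb a).2.2 x).1
    have h2 := hc _ (h1.trans (by gcongr))
    refine ⟨h2.1.trans ?_, h2.2.trans ?_⟩
    · rw [mul_assoc]; gcongr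
    · rw [mul_assoc, ← sq_abs x, ← mul_pow]; gcongr
  have hpi := Real.pi_pos
  refine ⟨C * B + C * B ^ 2 + (C * B * Real.pi + 1), by positivity, fun a x hx => ?_⟩
  obtain ⟨h1, h2⟩ := key a x hx
  refine ⟨h1.trans ?_, h2.trans ?_, ?_⟩
  · gcongr
    have : 0 ≤ C * B ^ 2 := by positivity
    have : 0 ≤ C * B * Real.pi := by positivity
    linarith
  · gcongr
    have : 0 ≤ C * B := by positivity
    have : 0 ≤ C * B * Real.pi := by positivity
    linarith
  · have h3 : ‖Complex.cos (increment w a x)‖ ≤ ‖Complex.cos (increment w a x) - 1‖ + 1 := by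
      simpa using norm_add_le (Complex.cos (increment w a x) - 1) 1
    have h4 : C * B * |x| ≤ C * B * Real.pi := by gcongr
    have : 0 ≤ C * B := by positivity
    have : 0 ≤ C * B ^ 2 := by positivity
    linarith

theorem exists_le_norm_sin (h : IsPeriodicCurve w w' w'') :
    ∃ δ, 0 < δ ∧ ∀ a x, |x| ≤ Real.pi → δ * |x| ≤ ‖Complex.sin (increment w a x)‖ := by
  obtain ⟨B, hB, hb⟩ := h.exists_bounds
  obtain ⟨C, hC, hc⟩ := h.exists_trig_bounds
  obtain ⟨m, hm, hm'⟩ := h.exists_le_norm_deriv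
  have hpi := Real.pi_pos
  refine exists_linear_lower_bound (p := 2 * Real.pi) (r := min Real.pi (m / (2 * (B + C))))
    (m := m / 2) Real.two_pi_pos ?_ ?_ ?_ (by positivity) (by positivity) ?_
  · exact (Complex.continuous_sin.comp h.continuous_increment).norm
  · intro a x; simp only [h.increment_periodic]
  · exact fun a x hx hxπ => norm_pos_iff.2 (h.sin_increment_ne_zero hx hxπ)
  · intro a x hx
    have hx1 := (le_min_iff.1 hx).1
    have hx2 : |x| * (2 * (B + C)) ≤ m := (le_div_iff₀ (by positivity)).1 (le_min_iff.1 hx).2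
    have h1 := ((hb a).2.2 x).2.1
    have h2 := (hc a x hx1).2.1
    have h3 : ‖(x : ℂ) * w' a‖ = |x| * ‖w' a‖ := by simp
    have h4 : (x : ℂ) * w' a = Complex.sin (increment w a x)
      - (Complex.sin (increment w a x) - increment w a x) - (increment w a x - x * w' a) := by ring
    have h5 := norm_sub_le (Complex.sin (increment w a x)
      - (Complex.sin (increment w a x) - increment w a x)) (increment w a x - x * w' a)
    have h6 := norm_sub_le (Complex.sin (increment w a x))
      (Complex.sin (increment w a x) - increment w a x)
    rw [← h4, h3] at h5
    have h7 : |x| * m ≤ |x| * ‖w' a‖ := by gcongr; exact hm' a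
    have h8 : |x| * (|x| * (2 * (B + C))) ≤ |x| * m := by gcongr
    have h9 : x ^ 2 = |x| * |x| := by rw [← sq, sq_abs]
    rw [h9] at h1 h2
    linarith

/-- The singular part `1 / x` of the kernel is real and does not depend on `a`. -/
theorem exists_cotKernel_sub_inv_le (h : IsPeriodicCurve w w' w'') :
    ∃ C, 0 < C ∧ ∀ a x, x ≠ 0 → |x| ≤ Real.pi → ‖cotKernel w w' a x - 1 / x‖ ≤ C := by
  obtain ⟨B, hB, hb⟩ := h.exists_bounds
  obtain ⟨C, hC, hc⟩ := h.exists_trig_bounds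
  obtain ⟨δ, hδ, hd⟩ := h.exists_le_norm_sin
  refine ⟨(B * C + B + C) / δ, by positivity, fun a x hx hxπ => ?_⟩
  have hs := h.sin_increment_ne_zero (a := a) hx hxπ
  have hxC : (x : ℂ) ≠ 0 := by exact_mod_cast hx
  obtain ⟨hb1, -, hb2⟩ := hb a
  obtain ⟨-, hb3, -⟩ := hb2 x
  obtain ⟨hc1, hc2, -⟩ := hc a x hxπ
  -- the numerator is `O(x²)`, the denominator at least of order `x²`
  have e : cotKernel w w' a x - 1 / x = (x * w' a * (Complex.cos (increment w a x) - 1)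
      - (increment w a x - x * w' a) - (Complex.sin (increment w a x) - increment w a x))
      / (x * Complex.sin (increment w a x)) := by
    rw [cotKernel, Complex.cot]; field_simp; ring
  have hx0 : 0 < |x| := abs_pos.2 hx
  rw [e, norm_div, norm_mul, Complex.norm_real, Real.norm_eq_abs,
    div_le_iff₀ (mul_pos hx0 (norm_pos_iff.2 hs))]
  have h1 : ‖(x : ℂ) * w' a * (Complex.cos (increment w a x) - 1)‖ ≤ |x| * B * (C * |x|) := by
    rw [norm_mul, norm_mul, Complex.norm_real, Real.norm_eq_abs]; gcongr
  have h2 : |x| * (δ * |x|) ≤ |x| * ‖Complex.sin (increment w a x)‖ := by gcongr; exact hd a x hxπ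
  have h3 : (B * C + B + C) / δ * (|x| * (δ * |x|)) = (B * C + B + C) * (|x| * |x|) := by
    field_simp
  have h4 : (B * C + B + C) / δ * (|x| * (δ * |x|))
      ≤ (B * C + B + C) / δ * (|x| * ‖Complex.sin (increment w a x)‖) := by gcongr
  have h9 : x ^ 2 = |x| * |x| := by rw [← sq, sq_abs]
  rw [h9] at hb3 hc2
  refine (norm_sub_le _ _).trans ?_
  have := norm_sub_le ((x : ℂ) * w' a * (Complex.cos (increment w a x) - 1))
    (increment w a x - x * w' a)
  linarith

theorem hasDerivAt_increment (h : IsPeriodicCurve w w' w'') (a x : ℝ) :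
    HasDerivAt (fun b => increment w b x) (increment w' a x) a :=
  ((h.hasDerivAt (a + x)).comp_add_const a x).sub (h.hasDerivAt a)

theorem hasDerivAt_cotKernel (h : IsPeriodicCurve w w' w'') {a x : ℝ} (hx : x ≠ 0)
    (hxπ : |x| ≤ Real.pi) :
    HasDerivAt (fun b => cotKernel w w' b x) (cotKernelDeriv w w' w'' a x) a := by
  have hs := h.sin_increment_ne_zero (a := a) hx hxπ
  have h1 := (h.hasDerivAt_increment a x)
  have hcos := (Complex.hasDerivAt_cos (increment w a x)).comp a h1
  have hsin := (Complex.hasDerivAt_sin (increment w a x)).comp a h1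
  have h2 := (h.hasDerivAt' a).mul (hcos.div hsin hs)
  refine h2.congr_deriv ?_
  simp only [Pi.div_apply, Function.comp_apply, cotKernelDeriv]
  field_simp
  have := Complex.sin_sq_add_cos_sq (increment w a x)
  linear_combination (-(w' a * increment w' a x)) * this

/-- As the singular part `1 / x` of the kernel is the same at all points `a`, differentiation
along the curve for fixed `x` does not make the kernel more singular. -/
theorem exists_cotKernelDeriv_le (h : IsPeriodicCurve w w' w'') :
    ∃ C, 0 < C ∧ ∀ a x, x ≠ 0 → |x| ≤ Real.pi → ‖cotKernelDeriv w w' w'' a x‖ ≤ C := by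
  obtain ⟨B, hB, hb⟩ := h.exists_bounds
  obtain ⟨C, hC, hc⟩ := h.exists_trig_bounds
  obtain ⟨δ, hδ, hd⟩ := h.exists_le_norm_sin
  refine ⟨(B * (C * C + B * C) + B * B + B * B) / δ ^ 2, by positivity, fun a x hx hxπ => ?_⟩
  have hs := h.sin_increment_ne_zero (a := a) hx hxπ
  obtain ⟨hb1, hb1', hb2⟩ := hb a
  obtain ⟨hb0, hb3, hb4⟩ := hb2 x
  obtain ⟨hc1, hc2, hc3⟩ := hc a x hxπ
  have h9 : x ^ 2 = |x| * |x| := by rw [← sq, sq_abs]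
  -- the terms `x w' w''` of first order in the numerator cancel
  have e : w'' a * (Complex.sin (increment w a x) * Complex.cos (increment w a x))
      - w' a * increment w' a x =
      w'' a * ((Complex.sin (increment w a x) - increment w a x) * Complex.cos (increment w a x)
        + increment w a x * (Complex.cos (increment w a x) - 1))
      + w'' a * (increment w a x - x * w' a) - w' a * (increment w' a x - x * w'' a) := by ring
  have h1 : ‖w'' a * ((Complex.sin (increment w a x) - increment w a x)
      * Complex.cos (increment w a x) + increment w a x * (Complex.cos (increment w a x) - 1))‖
      ≤ B * (C * x ^ 2 * C + B * |x| * (C * |x|)) := by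
    rw [norm_mul]
    gcongr
    refine (norm_add_le _ _).trans ?_
    rw [norm_mul, norm_mul]
    gcongr
  have h2 : ‖w'' a * (increment w a x - x * w' a)‖ ≤ B * (B * x ^ 2) := by
    rw [norm_mul]; gcongr
  have h3 : ‖w' a * (increment w' a x - x * w'' a)‖ ≤ B * (B * x ^ 2) := by
    rw [norm_mul]; gcongr
  rw [cotKernelDeriv, e, norm_div, norm_pow, div_le_iff₀ (by positivity)]
  have h4 : (δ * |x|) ^ 2 ≤ ‖Complex.sin (increment w a x)‖ ^ 2 := by gcongr; exact hd a x hxπ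
  have h5 : (B * (C * C + B * C) + B * B + B * B) / δ ^ 2 * (δ * |x|) ^ 2
      = (B * (C * C + B * C) + B * B + B * B) * (|x| * |x|) := by field_simp
  have h6 : (B * (C * C + B * C) + B * B + B * B) / δ ^ 2 * (δ * |x|) ^ 2
      ≤ (B * (C * C + B * C) + B * B + B * B) / δ ^ 2
        * ‖Complex.sin (increment w a x)‖ ^ 2 := by gcongr
  rw [h9] at h1 h2 h3
  refine (norm_sub_le _ _).trans ?_
  have := norm_add_le (w'' a * ((Complex.sin (increment w a x) - increment w a x)
      * Complex.cos (increment w a x) + increment w a x * (Complex.cos (increment w a x) - 1)))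
      (w'' a * (increment w a x - x * w' a))
  linarith

end IsPeriodicCurve

/-! ### The symmetrized periodic singular integral -/

theorem intervalIntegrable_of_bound {E : Type*} [NormedAddCommGroup E] {f : ℝ → E} {a b C : ℝ}
    (hab : a ≤ b) (hf : AEStronglyMeasurable f) (hC : ∀ x ∈ Set.Ioc a b, ‖f x‖ ≤ C) :
    IntervalIntegrable f volume a b := by
  rw [intervalIntegrable_iff, Set.uIoc_of_le hab]
  exact IntegrableOn.of_bound measure_Ioc_lt_top hf.restrict C
    ((ae_restrict_iff' measurableSet_Ioc).2 (Eventually.of_forall hC))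

theorem integral_comp_add_of_periodic {φ : ℝ → ℝ} {T : ℝ} (hφ : Function.Periodic φ T) (x : ℝ) :
    ∫ a in (0 : ℝ)..T, φ (a + x) = ∫ a in (0 : ℝ)..T, φ a := by
  rw [intervalIntegral.integral_comp_add_right, zero_add, add_comm T x,
    hφ.intervalIntegral_add_eq x 0, zero_add]

theorem hasDerivAt_log_norm {f : ℝ → ℂ} {f' : ℂ} {x : ℝ} (hf : HasDerivAt f f' x)
    (h0 : f x ≠ 0) : HasDerivAt (fun y => Real.log ‖f y‖) (f' / f x).re x := by
  have hre : HasDerivAt (fun y => (f y).re) f'.re x :=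
    Complex.reCLM.hasFDerivAt.comp_hasDerivAt x hf
  have him : HasDerivAt (fun y => (f y).im) f'.im x :=
    Complex.imCLM.hasFDerivAt.comp_hasDerivAt x hf
  have hn : Complex.normSq (f x) ≠ 0 := by simpa using h0
  have h1 : HasDerivAt (fun y => Complex.normSq (f y))
      (2 * ((f x).re * f'.re + (f x).im * f'.im)) x := by
    simp only [Complex.normSq_apply]
    exact ((hre.mul hre).add (him.mul him)).congr_deriv (by ring)
  have h2 := (h1.log hn).div_const 2
  have e : (fun y => Real.log ‖f y‖) = fun y => Real.log (Complex.normSq (f y)) / 2 := by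
    funext y
    rw [Complex.normSq_eq_norm_sq, Real.log_pow]; push_cast; ring
  rw [e]
  refine h2.congr_deriv ?_
  rw [Complex.div_re]
  field_simp

/-- The sum of the values at `a + x` and `a - x` of the integrand of the periodized singular
integral of `γ`. The singularities at `x = 0` cancel in the sum. -/
def symmKernel (w w' : ℝ → ℂ) (γ : ℝ → ℝ) (a x : ℝ) : ℂ :=
  γ (a + x) * cotKernel w w' a x + γ (a - x) * cotKernel w w' a (-x)

/-- The kernel of the adjoint operation, in which `γ` stays at the point `a` and the kernel is
evaluated from the points `a - x` and `a + x`. -/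
def adjointKernel (w w' : ℝ → ℂ) (γ : ℝ → ℝ) (a x : ℝ) : ℂ :=
  γ a * (cotKernel w w' (a - x) x + cotKernel w w' (a + x) (-x))

namespace IsPeriodicCurve

variable {w w' w'' : ℝ → ℂ} {γ : ℝ → ℝ}

theorem measurable_cotKernel (h : IsPeriodicCurve w w' w'') :
    Measurable (Function.uncurry (cotKernel w w')) := by
  have h1 := h.continuous_increment
  have h2 := h.continuous'
  have h3 : Measurable fun q : ℝ × ℝ => Complex.cos (increment w q.1 q.2) :=
    (Complex.continuous_cos.comp h1).measurable
  have h4 : Measurable fun q : ℝ × ℝ => Complex.sin (increment w q.1 q.2) :=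
    (Complex.continuous_sin.comp h1).measurable
  have h5 : Measurable fun q : ℝ × ℝ => w' q.1 := (h2.comp continuous_fst).measurable
  exact h5.mul (h3.div h4)

theorem measurable_symmKernel (h : IsPeriodicCurve w w' w'') (hγ : Continuous γ) :
    Measurable (Function.uncurry (symmKernel w w' γ)) := by
  have h1 : Measurable fun q : ℝ × ℝ => (γ (q.1 + q.2) : ℂ) := by
    apply Continuous.measurable; fun_prop
  have h2 : Measurable fun q : ℝ × ℝ => (γ (q.1 - q.2) : ℂ) := by
    apply Continuous.measurable; fun_prop
  have h3 : Measurable fun q : ℝ × ℝ => cotKernel w w' q.1 (-q.2) :=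
    h.measurable_cotKernel.comp (measurable_fst.prodMk measurable_snd.neg)
  exact (h1.mul h.measurable_cotKernel).add (h2.mul h3)

theorem measurable_adjointKernel (h : IsPeriodicCurve w w' w'') (hγ : Continuous γ) :
    Measurable (Function.uncurry (adjointKernel w w' γ)) := by
  have h1 : Measurable fun q : ℝ × ℝ => (γ q.1 : ℂ) := by
    apply Continuous.measurable; fun_prop
  have h2 : Measurable fun q : ℝ × ℝ => cotKernel w w' (q.1 - q.2) q.2 :=
    h.measurable_cotKernel.comp ((measurable_fst.sub measurable_snd).prodMk measurable_snd)
  have h3 : Measurable fun q : ℝ × ℝ => cotKernel w w' (q.1 + q.2) (-q.2) :=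
    h.measurable_cotKernel.comp ((measurable_fst.add measurable_snd).prodMk measurable_snd.neg)
  exact h1.mul (h2.add h3)

theorem continuous_cotKernel (h : IsPeriodicCurve w w' w'') {x : ℝ} (hx : x ≠ 0)
    (hxπ : |x| ≤ Real.pi) : Continuous fun a => cotKernel w w' a x :=
  continuous_iff_continuousAt.2 fun _ => (h.hasDerivAt_cotKernel hx hxπ).continuousAt

theorem cotKernel_periodic (h : IsPeriodicCurve w w' w'') (x : ℝ) :
    Function.Periodic (fun a => cotKernel w w' a x) (2 * Real.pi) := fun a => by
  simp only [cotKernel, h.increment_periodic, h.periodic' a]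

/-- Symmetrization removes the singularity: for `symmKernel` because `γ` is Lipschitz, for
`adjointKernel` because the singular parts `γ(a) / x` cancel exactly. -/
theorem exists_symmKernel_le (h : IsPeriodicCurve w w' w'') (hγ : ContDiff ℝ 1 γ)
    (hper : Function.Periodic γ (2 * Real.pi)) :
    ∃ C, 0 < C ∧ ∀ a x, x ≠ 0 → |x| ≤ Real.pi →
      ‖symmKernel w w' γ a x‖ ≤ C ∧ ‖adjointKernel w w' γ a x‖ ≤ C := by
  obtain ⟨C, hC, hc⟩ := h.exists_cotKernel_sub_inv_le
  obtain ⟨B, hB, hb⟩ := exists_norm_le_of_periodic hγ.continuous hper Real.two_pi_pos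
  have hdper : Function.Periodic (deriv γ) (2 * Real.pi) := fun a => by
    rw [← deriv_comp_add_const, show (fun x => γ (x + 2 * Real.pi)) = γ from funext hper]
  obtain ⟨B', hB', hb'⟩ := exists_norm_le_of_periodic (hγ.continuous_deriv le_rfl) hdper
    Real.two_pi_pos
  have hlip : ∀ a b, ‖γ a - γ b‖ ≤ B' * |a - b| := norm_sub_le_of_hasDerivAt
    (fun y => (hγ.differentiable one_ne_zero y).hasDerivAt) hb'
  refine ⟨B * C + B * C + 2 * B', by positivity, fun a x hx hxπ => ⟨?_, ?_⟩⟩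
  · have h1 := hc a x hx hxπ
    have h2 := hc a (-x) (neg_ne_zero.2 hx) (by rwa [abs_neg])
    have hxC : (x : ℂ) ≠ 0 := by exact_mod_cast hx
    have e : symmKernel w w' γ a x = γ (a + x) * (cotKernel w w' a x - 1 / x)
        + γ (a - x) * (cotKernel w w' a (-x) - 1 / ((-x : ℝ) : ℂ))
        + ((γ (a + x) - γ (a - x) : ℝ) : ℂ) / x := by
      rw [symmKernel]; push_cast; field_simp; ring
    rw [e]
    refine (norm_add_le _ _).trans (add_le_add ((norm_add_le _ _).trans (add_le_add ?_ ?_)) ?_)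
    · rw [norm_mul, Complex.norm_real]; gcongr; exact hb _
    · rw [norm_mul, Complex.norm_real]; gcongr; exact hb _
    · rw [norm_div, Complex.norm_real, Complex.norm_real, div_le_iff₀ (norm_pos_iff.2 hx)]
      refine (hlip _ _).trans (le_of_eq ?_)
      rw [show a + x - (a - x) = 2 * x by ring, abs_mul, Real.norm_eq_abs, abs_two]; ring
  · have h1 := hc (a - x) x hx hxπ
    have h2 := hc (a + x) (-x) (neg_ne_zero.2 hx) (by rwa [abs_neg])
    have hxC : (x : ℂ) ≠ 0 := by exact_mod_cast hx
    have e : adjointKernel w w' γ a x = γ a * (cotKernel w w' (a - x) x - 1 / x)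
        + γ a * (cotKernel w w' (a + x) (-x) - 1 / ((-x : ℝ) : ℂ)) := by
      rw [adjointKernel]; push_cast; field_simp; ring
    rw [e]
    have : ‖(γ a : ℂ) * (cotKernel w w' (a - x) x - 1 / x)‖ ≤ B * C := by
      rw [norm_mul, Complex.norm_real]; gcongr; exact hb _
    have : ‖(γ a : ℂ) * (cotKernel w w' (a + x) (-x) - 1 / ((-x : ℝ) : ℂ))‖ ≤ B * C := by
      rw [norm_mul, Complex.norm_real]; gcongr; exact hb _
    refine (norm_add_le _ _).trans ?_
    linarith

theorem intervalIntegrable_symmKernel (h : IsPeriodicCurve w w' w'') (hγ : ContDiff ℝ 1 γ)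
    (hper : Function.Periodic γ (2 * Real.pi)) (a : ℝ) :
    IntervalIntegrable (symmKernel w w' γ a) volume 0 Real.pi := by
  obtain ⟨C, hC, hc⟩ := h.exists_symmKernel_le hγ hper
  exact intervalIntegrable_of_bound Real.pi_pos.le
    ((h.measurable_symmKernel hγ.continuous).comp measurable_prodMk_left).aestronglyMeasurable
    fun x hx => (hc a x hx.1.ne' (by rw [abs_of_pos hx.1]; exact hx.2)).1

/-- The adjoint kernel is the derivative of `log |sin|` of the differences, which takes equal
values at the ends of the interval of integration. -/
theorem integral_re_adjointKernel (h : IsPeriodicCurve w w' w'') (γ : ℝ → ℝ) (a : ℝ) :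
    ∫ x in (0 : ℝ)..Real.pi, (adjointKernel w w' γ a x).re = 0 := by
  obtain ⟨C, hC, hc⟩ := h.exists_symmKernel_le (γ := fun _ => 1) contDiff_const (fun _ => rfl)
  have e : ∀ x, (adjointKernel w w' γ a x).re
      = γ a * (adjointKernel w w' (fun _ => 1) a x).re := fun x => by
    rw [adjointKernel, adjointKernel, Complex.re_ofReal_mul]; simp
  simp_rw [e]
  rw [intervalIntegral.integral_const_mul]
  have e1 : ∀ x, increment w (a - x) x = w a - w (a - x) := fun x => by simp [increment]
  have e2 : ∀ x, increment w (a + x) (-x) = w a - w (a + x) := fun x => by simp [increment]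
  have d1 : ∀ x, HasDerivAt (fun x => Complex.sin (w a - w (a - x)))
      (Complex.cos (w a - w (a - x)) * w' (a - x)) x := fun x => by
    have := ((h.hasDerivAt (a - x)).comp_const_sub a x).const_sub (w a)
    rw [neg_neg] at this
    exact (Complex.hasDerivAt_sin _).comp x this
  have d2 : ∀ x, HasDerivAt (fun x => Complex.sin (w a - w (a + x)))
      (Complex.cos (w a - w (a + x)) * -w' (a + x)) x := fun x => by
    have := ((h.hasDerivAt (a + x)).comp_const_add a x).const_sub (w a)
    exact (Complex.hasDerivAt_sin _).comp x this
  have n1 : ∀ x, x ≠ 0 → |x| ≤ Real.pi → Complex.sin (w a - w (a - x)) ≠ 0 := fun x hx hxπ => by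
    rw [← e1]; exact h.sin_increment_ne_zero hx hxπ
  have n2 : ∀ x, x ≠ 0 → |x| ≤ Real.pi → Complex.sin (w a - w (a + x)) ≠ 0 := fun x hx hxπ => by
    rw [← e2]; exact h.sin_increment_ne_zero (neg_ne_zero.2 hx) (by rwa [abs_neg])
  set L : ℝ → ℝ := fun x => Real.log ‖Complex.sin (w a - w (a - x))‖
    - Real.log ‖Complex.sin (w a - w (a + x))‖ with hL
  have dL : ∀ x, x ≠ 0 → |x| ≤ Real.pi →
      HasDerivAt L (adjointKernel w w' (fun _ => 1) a x).re x := fun x hx hxπ => by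
    refine ((hasDerivAt_log_norm (d1 x) (n1 x hx hxπ)).sub
      (hasDerivAt_log_norm (d2 x) (n2 x hx hxπ))).congr_deriv ?_
    rw [adjointKernel, cotKernel, cotKernel, e1, e2, Complex.cot, Complex.cot, ← Complex.sub_re]
    congr 1
    push_cast
    ring
  -- the points `a - π` and `a + π` differ by a period
  have hLπ : L Real.pi = 0 := by
    have : w (a + Real.pi) = w (a - Real.pi) + Real.pi := by
      rw [← h.translate]; congr 1; ring
    rw [hL]
    simp only [this]
    rw [← sub_sub, Complex.sin_sub_pi, norm_neg, sub_self]
  -- near `x = 0` both sines are asymptotic to multiples of `w'(a) x` of equal modulus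
  have t1 : Tendsto (fun x : ℝ => ‖(x : ℝ)⁻¹ • Complex.sin (w a - w (a - x))‖) (𝓝[>] 0)
      (𝓝 ‖w' a‖) := by
    have := (d1 0).tendsto_slope_zero_right
    simpa using this.norm
  have t2 : Tendsto (fun x : ℝ => ‖(x : ℝ)⁻¹ • Complex.sin (w a - w (a + x))‖) (𝓝[>] 0)
      (𝓝 ‖w' a‖) := by
    have := (d2 0).tendsto_slope_zero_right
    simpa using this.norm
  have n0 : ‖w' a‖ ≠ 0 := norm_ne_zero_iff.2 (h.regular a)
  have tL : Tendsto L (𝓝[>] 0) (𝓝 0) := by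
    have := ((Real.continuousAt_log n0).tendsto.comp t1).sub
      ((Real.continuousAt_log n0).tendsto.comp t2)
    rw [sub_self] at this
    refine this.congr' ?_
    filter_upwards [Ioo_mem_nhdsGT Real.pi_pos] with x hx
    have hx0 : x ≠ 0 := hx.1.ne'
    have hxπ : |x| ≤ Real.pi := by rw [abs_of_pos hx.1]; exact hx.2.le
    simp only [Function.comp_apply, hL, norm_smul, norm_inv]
    rw [Real.log_mul (by simpa using hx0) (norm_ne_zero_iff.2 (n1 x hx0 hxπ)),
      Real.log_mul (by simpa using hx0) (norm_ne_zero_iff.2 (n2 x hx0 hxπ))]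
    ring
  rw [intervalIntegral.integral_eq_sub_of_hasDerivAt_of_tendsto (f := L) (fa := 0) (fb := 0)
    Real.pi_pos (fun x hx => dL x hx.1.ne' (by rw [abs_of_pos hx.1]; exact hx.2.le)) ?_ tL ?_]
  · simp
  · refine intervalIntegrable_of_bound (C := C) Real.pi_pos.le ?_ fun x hx => ?_
    · exact (Complex.measurable_re.comp ((h.measurable_adjointKernel continuous_const).comp
        measurable_prodMk_left)).aestronglyMeasurable
    · exact (Complex.abs_re_le_norm _).trans
        (hc a x hx.1.ne' (by rw [abs_of_pos hx.1]; exact hx.2)).2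
  · have := (dL Real.pi Real.pi_pos.ne' (by rw [abs_of_pos Real.pi_pos])).continuousAt.tendsto
    rw [hLπ] at this
    exact this.mono_left nhdsWithin_le_nhds

/-- A shift of the variable `a` by `x` carries the kernel to its adjoint. -/
theorem integral_re_symmKernel_eq (h : IsPeriodicCurve w w' w'') (hγ : Continuous γ)
    (hper : Function.Periodic γ (2 * Real.pi)) {x : ℝ} (hx : x ≠ 0) (hxπ : |x| ≤ Real.pi) :
    ∫ a in (0 : ℝ)..(2 * Real.pi), (symmKernel w w' γ a x).re
      = ∫ a in (0 : ℝ)..(2 * Real.pi), (adjointKernel w w' γ a x).re := by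
  have key : ∀ y, y ≠ 0 → |y| ≤ Real.pi →
      Continuous (fun a => γ (a + y) * (cotKernel w w' a y).re) ∧
      Continuous (fun a => γ a * (cotKernel w w' (a - y) y).re) ∧
      ∫ a in (0 : ℝ)..(2 * Real.pi), γ (a + y) * (cotKernel w w' a y).re
      = ∫ a in (0 : ℝ)..(2 * Real.pi), γ a * (cotKernel w w' (a - y) y).re := fun y hy hyπ => by
    have hk : Continuous fun a => (cotKernel w w' a y).re :=
      Complex.continuous_re.comp (h.continuous_cotKernel hy hyπ)
    refine ⟨by fun_prop, hγ.mul (hk.comp (continuous_id.sub continuous_const)), ?_⟩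
    have hφ : Function.Periodic (fun a => γ a * (cotKernel w w' (a - y) y).re)
        (2 * Real.pi) := fun a => by
      have := h.cotKernel_periodic y (a - y)
      simp only at this ⊢
      rw [hper a, ← this, add_sub_right_comm]
    rw [← integral_comp_add_of_periodic hφ y]
    simp
  obtain ⟨c1, c1', h1⟩ := key x hx hxπ
  obtain ⟨c2, c2', h2⟩ := key (-x) (neg_ne_zero.2 hx) (by rwa [abs_neg])
  simp only [symmKernel, adjointKernel, Complex.add_re, Complex.re_ofReal_mul, mul_add]
  simp only [← sub_eq_add_neg, sub_neg_eq_add] at h2 c2 c2'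
  rw [intervalIntegral.integral_add (c1.intervalIntegrable _ _) (c2.intervalIntegrable _ _),
    intervalIntegral.integral_add (c1'.intervalIntegrable _ _) (c2'.intervalIntegrable _ _), h1, h2]

/-- The flux of the velocity through one period of the curve vanishes: exchange the integrals
over the curve and over the distance, and pass to the adjoint kernel. -/
theorem integral_re_integral_symmKernel (h : IsPeriodicCurve w w' w'') (hγ : ContDiff ℝ 1 γ)
    (hper : Function.Periodic γ (2 * Real.pi)) :
    ∫ a in (0 : ℝ)..(2 * Real.pi), (∫ x in (0 : ℝ)..Real.pi, symmKernel w w' γ a x).re = 0 := by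
  obtain ⟨C, hC, hc⟩ := h.exists_symmKernel_le hγ hper
  have hre : ∀ a, (∫ x in (0 : ℝ)..Real.pi, symmKernel w w' γ a x).re
      = ∫ x in (0 : ℝ)..Real.pi, (symmKernel w w' γ a x).re := fun a =>
    (Complex.reCLM.intervalIntegral_comp_comm (h.intervalIntegrable_symmKernel hγ hper a)).symm
  simp_rw [hre]
  have hfub : ∀ F : ℝ → ℝ → ℂ, Measurable (Function.uncurry F) →
      (∀ a x, x ≠ 0 → |x| ≤ Real.pi → ‖F a x‖ ≤ C) →
      ∫ a in (0 : ℝ)..(2 * Real.pi), ∫ x in (0 : ℝ)..Real.pi, (F a x).re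
        = ∫ x in (0 : ℝ)..Real.pi, ∫ a in (0 : ℝ)..(2 * Real.pi), (F a x).re := fun F hF hFC => by
    refine intervalIntegral_intervalIntegral_swap (F := fun a x => (F a x).re) ?_
    rw [Set.uIoc_of_le Real.two_pi_pos.le, Set.uIoc_of_le Real.pi_pos.le]
    refine IntegrableOn.of_bound ?_ (Complex.measurable_re.comp hF).aestronglyMeasurable C ?_
    · rw [Measure.volume_eq_prod, Measure.prod_prod]
      exact ENNReal.mul_lt_top measure_Ioc_lt_top measure_Ioc_lt_top
    · refine (ae_restrict_iff' (measurableSet_Ioc.prod measurableSet_Ioc)).2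
        (Eventually.of_forall fun q hq => ?_)
      have hx := hq.2
      exact (Complex.abs_re_le_norm _).trans
        (hFC q.1 q.2 hx.1.ne' (by rw [abs_of_pos hx.1]; exact hx.2))
  rw [hfub _ (h.measurable_symmKernel hγ.continuous) fun a x hx hxπ => (hc a x hx hxπ).1]
  have hcongr : ∀ x ∈ Set.uIoc 0 Real.pi,
      ∫ a in (0 : ℝ)..(2 * Real.pi), (symmKernel w w' γ a x).re
      = ∫ a in (0 : ℝ)..(2 * Real.pi), (adjointKernel w w' γ a x).re := fun x hx => by
    rw [Set.uIoc_of_le Real.pi_pos.le] at hx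
    exact h.integral_re_symmKernel_eq hγ.continuous hper hx.1.ne'
      (by rw [abs_of_pos hx.1]; exact hx.2)
  rw [intervalIntegral.integral_congr_ae (Eventually.of_forall hcongr),
    ← hfub _ (h.measurable_adjointKernel hγ.continuous) fun a x hx hxπ => (hc a x hx hxπ).2]
  simp_rw [h.integral_re_adjointKernel γ]
  simp

end IsPeriodicCurve

/-! ### Differentiation along the curve -/

namespace IsPeriodicCurve

variable {w w' w'' : ℝ → ℂ} {γ : ℝ → ℝ}

theorem measurable_cotKernelDeriv (h : IsPeriodicCurve w w' w'') (a : ℝ) :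
    Measurable (cotKernelDeriv w w' w'' a) := by
  have h1 : Continuous (increment w a) := by
    have := h.continuous
    unfold increment; fun_prop
  have h2 : Continuous (increment w' a) := by
    have := h.continuous'
    unfold increment; fun_prop
  have h3 := Complex.continuous_sin.comp h1
  have h4 := Complex.continuous_cos.comp h1
  exact ((measurable_const.mul (h3.mul h4).measurable).sub
    (measurable_const.mul h2.measurable)).div (h3.measurable.pow_const 2)

/-- The singular part of `cotKernel` is real, so its imaginary part is bounded, as is the derivative
of the latter along the curve. Hence one may differentiate under the integral sign with no more
than a `C¹` density. -/
theorem differentiable_im_integral_symmKernel (h : IsPeriodicCurve w w' w'')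
    (hγ : ContDiff ℝ 1 γ) (hper : Function.Periodic γ (2 * Real.pi)) :
    Differentiable ℝ fun a => (∫ x in (0 : ℝ)..Real.pi, symmKernel w w' γ a x).im := by
  obtain ⟨C, hC, hc⟩ := h.exists_cotKernel_sub_inv_le
  obtain ⟨C', hC', hc'⟩ := h.exists_cotKernelDeriv_le
  obtain ⟨B, hB, hb⟩ := exists_norm_le_of_periodic hγ.continuous hper Real.two_pi_pos
  have hdper : Function.Periodic (deriv γ) (2 * Real.pi) := fun a => by
    rw [← deriv_comp_add_const, show (fun x => γ (x + 2 * Real.pi)) = γ from funext hper]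
  have hdcont := hγ.continuous_deriv le_rfl
  obtain ⟨B', hB', hb'⟩ := exists_norm_le_of_periodic hdcont hdper Real.two_pi_pos
  have hdγ : ∀ y, HasDerivAt γ (deriv γ y) y := fun y =>
    (hγ.differentiable one_ne_zero y).hasDerivAt
  have him : ∀ a, (∫ x in (0 : ℝ)..Real.pi, symmKernel w w' γ a x).im
      = ∫ x in (0 : ℝ)..Real.pi, (symmKernel w w' γ a x).im := fun a =>
    (Complex.imCLM.intervalIntegral_comp_comm (h.intervalIntegrable_symmKernel hγ hper a)).symm
  simp_rw [him]
  have hkim : ∀ a x, x ≠ 0 → |x| ≤ Real.pi → |(cotKernel w w' a x).im| ≤ C := fun a x hx hxπ => by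
    have : (cotKernel w w' a x).im = (cotKernel w w' a x - 1 / x).im := by
      rw [← Complex.ofReal_one, ← Complex.ofReal_div, Complex.sub_im, Complex.ofReal_im, sub_zero]
    rw [this]
    exact (Complex.abs_im_le_norm _).trans (hc a x hx hxπ)
  set K' : ℝ → ℝ → ℝ := fun a y => deriv γ (a + y) * (cotKernel w w' a y).im
    + γ (a + y) * (cotKernelDeriv w w' w'' a y).im with hK'
  have dK : ∀ a y, y ≠ 0 → |y| ≤ Real.pi →
      HasDerivAt (fun b => γ (b + y) * (cotKernel w w' b y).im) (K' a y) a := fun a y hy hyπ =>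
    ((hdγ (a + y)).comp_add_const a y).mul
      (Complex.imCLM.hasFDerivAt.comp_hasDerivAt a (h.hasDerivAt_cotKernel hy hyπ))
  have bK : ∀ a y, y ≠ 0 → |y| ≤ Real.pi → ‖K' a y‖ ≤ B' * C + B * C' := fun a y hy hyπ => by
    refine (norm_add_le _ _).trans ?_
    rw [norm_mul, norm_mul]
    gcongr
    · exact hb' _
    · exact hkim a y hy hyπ
    · exact hb _
    · exact (Complex.abs_im_le_norm _).trans (hc' a y hy hyπ)
  have mK : ∀ a, Measurable (K' a) := fun a => by
    have h1 : Measurable fun y => deriv γ (a + y) := by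
      apply Continuous.measurable; fun_prop
    have h2 : Measurable fun y => γ (a + y) := by
      have := hγ.continuous
      apply Continuous.measurable; fun_prop
    exact (h1.mul (Complex.measurable_im.comp (h.measurable_cotKernel.comp
      measurable_prodMk_left))).add (h2.mul (Complex.measurable_im.comp
        (h.measurable_cotKernelDeriv a)))
  have mG : ∀ a, AEStronglyMeasurable (fun x => (symmKernel w w' γ a x).im) volume := fun a =>
    (Complex.measurable_im.comp ((h.measurable_symmKernel hγ.continuous).comp
      measurable_prodMk_left)).aestronglyMeasurable
  intro a₀
  refine (intervalIntegral.hasDerivAt_integral_of_dominated_loc_of_deriv_le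
    (F' := fun a x => K' a x + K' a (-x)) (s := Set.univ)
    (bound := fun _ => (B' * C + B * C') + (B' * C + B * C')) univ_mem
    (Eventually.of_forall fun a => (mG a).restrict) ?_ ?_ ?_ ?_ ?_).2.differentiableAt
  · exact ⟨(h.intervalIntegrable_symmKernel hγ hper a₀).1.im,
      (h.intervalIntegrable_symmKernel hγ hper a₀).2.im⟩
  · exact ((mK a₀).add ((mK a₀).comp measurable_neg)).aestronglyMeasurable
  · refine Eventually.of_forall fun x hx a _ => ?_
    rw [Set.uIoc_of_le Real.pi_pos.le] at hx
    have hxπ : |x| ≤ Real.pi := by rw [abs_of_pos hx.1]; exact hx.2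
    exact (norm_add_le _ _).trans (add_le_add (bK a x hx.1.ne' hxπ)
      (bK a (-x) (neg_ne_zero.2 hx.1.ne') (by rwa [abs_neg])))
  · exact intervalIntegrable_const
  · refine Eventually.of_forall fun x hx a _ => ?_
    rw [Set.uIoc_of_le Real.pi_pos.le] at hx
    have hxπ : |x| ≤ Real.pi := by rw [abs_of_pos hx.1]; exact hx.2
    have := (dK a x hx.1.ne' hxπ).add (dK a (-x) (neg_ne_zero.2 hx.1.ne') (by rwa [abs_neg]))
    refine this.congr_of_eventuallyEq (Eventually.of_forall fun b => ?_)
    simp [symmKernel, sub_eq_add_neg]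

end IsPeriodicCurve

/-! ### The conditionally convergent integral at infinity -/

/-- The Mittag-Leffler expansion of the cotangent without its pole at the origin. At `v = 0` both
sides vanish, with the conventions `cot 0 = 0` and `1 / 0 = 0`. -/
theorem tendsto_sum_cotangent {v : ℂ} (hv : ∀ n : ℤ, n ≠ 0 → v ≠ n * Real.pi) :
    Tendsto (fun N : ℕ => ∑ j ∈ Finset.range N,
      (1 / (v - (j + 1) * Real.pi) + 1 / (v + (j + 1) * Real.pi))) atTop
      (𝓝 (Complex.cot v - 1 / v)) := by
  have hpi : (Real.pi : ℂ) ≠ 0 := by exact_mod_cast Real.pi_ne_zero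
  rcases eq_or_ne v 0 with rfl | h0
  · simp [Complex.cot]
  · have hmem : v / Real.pi ∈ Complex.integerComplement := by
      rintro ⟨n, hn⟩
      have hvn : v = n * Real.pi := by
        rw [hn]; field_simp
      rcases eq_or_ne n 0 with rfl | hn0
      · exact h0 (by simpa using hvn)
      · exact hv n hn0 hvn
    have h1 := (tendsto_logDeriv_euler_cot_sub hmem).mul_const (1 / (Real.pi : ℂ))
    have e : (Real.pi * Complex.cot (Real.pi * (v / Real.pi)) - 1 / (v / Real.pi))
        * (1 / (Real.pi : ℂ)) = Complex.cot v - 1 / v := by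
      rw [mul_div_cancel₀ v hpi]; field_simp
    rw [e] at h1
    refine h1.congr fun N => ?_
    rw [Finset.sum_mul]
    refine Finset.sum_congr rfl fun j _ => ?_
    have e1 : v / Real.pi - (j + 1) = (v - (j + 1) * Real.pi) / Real.pi := by field_simp
    have e2 : v / Real.pi + (j + 1) = (v + (j + 1) * Real.pi) / Real.pi := by field_simp
    simp only [cotTerm]
    rw [e1, e2, one_div_div, one_div_div, add_mul, div_mul_div_comm, div_mul_div_comm]
    congr 1 <;> field_simp

/-- An integral whose integrand decays like `1 / x` converges as soon as it converges along the
odd multiples of `π`. -/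
theorem tendsto_integral_of_tendsto_odd {s : ℝ → ℂ} {C : ℝ} {l : ℂ}
    (hs : ContinuousOn s (Set.Ici Real.pi)) (hC : ∀ x, Real.pi ≤ x → ‖s x‖ ≤ C / x)
    (hl : Tendsto (fun N : ℕ => ∫ x in Real.pi..((2 * N + 1) * Real.pi), s x) atTop (𝓝 l)) :
    Tendsto (fun R => ∫ x in Real.pi..R, s x) atTop (𝓝 l) := by
  have hpi := Real.pi_pos
  have hint : ∀ a b, Real.pi ≤ a → Real.pi ≤ b → IntervalIntegrable s volume a b :=
    fun a b ha hb => (hs.mono fun x hx => le_trans (le_min ha hb) hx.1).intervalIntegrable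
  -- `(2 N + 1) π` is the last odd multiple of `π` that does not exceed `R`
  set N : ℝ → ℕ := fun R => ⌊(R - Real.pi) / (2 * Real.pi)⌋₊ with hN
  have tN : Tendsto N atTop atTop := by
    refine tendsto_nat_floor_atTop.comp (Tendsto.atTop_div_const Real.two_pi_pos ?_)
    exact tendsto_atTop_add_const_right _ (-Real.pi) tendsto_id
  have hC0 : 0 ≤ C := by
    have := (norm_nonneg _).trans (hC Real.pi le_rfl)
    exact nonneg_of_mul_nonneg_left (by rwa [div_eq_mul_inv] at this) (by positivity)
  have hdiff : Tendsto (fun R => (∫ x in Real.pi..R, s x)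
      - ∫ x in Real.pi..((2 * N R + 1) * Real.pi), s x) atTop (𝓝 0) := by
    have hlim : Tendsto (fun R => C / ((2 * (N R : ℝ) + 1) * Real.pi) * (2 * Real.pi)) atTop
        (𝓝 0) := by
      rw [show (0 : ℝ) = 0 * (2 * Real.pi) by ring]
      refine Tendsto.mul_const _ (tendsto_const_nhds.div_atTop ?_)
      refine Tendsto.atTop_mul_const hpi (tendsto_atTop_add_const_right _ _ ?_)
      exact (tendsto_natCast_atTop_atTop.comp tN).const_mul_atTop two_pos
    refine squeeze_zero_norm' ?_ hlim
    filter_upwards [eventually_ge_atTop Real.pi] with R hR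
    set b := (2 * (N R : ℝ) + 1) * Real.pi with hb
    have h0 : 0 ≤ (R - Real.pi) / (2 * Real.pi) := by
      have := sub_nonneg.2 hR
      positivity
    have h1 : (N R : ℝ) * (2 * Real.pi) ≤ R - Real.pi :=
      (le_div_iff₀ Real.two_pi_pos).1 (Nat.floor_le h0)
    have h2 : R - Real.pi < (N R + 1 : ℝ) * (2 * Real.pi) :=
      (div_lt_iff₀ Real.two_pi_pos).1 (Nat.lt_floor_add_one _)
    have hbpi : Real.pi ≤ b := by
      have : 0 ≤ 2 * (N R : ℝ) * Real.pi := by positivity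
      rw [hb]; linarith
    have hbR : b ≤ R := by rw [hb]; linarith
    have hb0 : 0 < b := hpi.trans_le hbpi
    rw [intervalIntegral.integral_interval_sub_left (hint _ _ le_rfl hR) (hint _ _ le_rfl hbpi)]
    refine (intervalIntegral.norm_integral_le_of_norm_le_const (C := C / b) fun x hx => ?_).trans ?_
    · rw [Set.uIoc_of_le hbR] at hx
      exact (hC x (hbpi.trans hx.1.le)).trans (by gcongr; exact hx.1.le)
    · rw [abs_of_nonneg (sub_nonneg.2 hbR)]
      gcongr
      rw [hb]; linarith
  have := hdiff.add (hl.comp tN)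
  rw [zero_add] at this
  refine this.congr fun R => ?_
  simp

theorem intervalIntegrable_symmetrize {s : ℝ → ℂ} {c r : ℝ}
    (h1 : IntervalIntegrable s volume (c - r) c) (h2 : IntervalIntegrable s volume c (c + r)) :
    IntervalIntegrable (fun x => s (c + x)) volume 0 r ∧
      IntervalIntegrable (fun x => s (c - x)) volume 0 r :=
  ⟨by simpa using h2.comp_add_left c, by simpa using (h1.comp_sub_left c).symm⟩

theorem integral_symmetrize {s : ℝ → ℂ} {c r : ℝ}
    (h1 : IntervalIntegrable s volume (c - r) c) (h2 : IntervalIntegrable s volume c (c + r)) :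
    ∫ x in (c - r)..(c + r), s x = ∫ x in (0 : ℝ)..r, (s (c + x) + s (c - x)) := by
  obtain ⟨i1, i2⟩ := intervalIntegrable_symmetrize h1 h2
  rw [intervalIntegral.integral_add i1 i2, intervalIntegral.integral_comp_add_left,
    intervalIntegral.integral_comp_sub_left, add_zero, sub_zero,
    ← intervalIntegral.integral_add_adjacent_intervals h1 h2]
  exact add_comm _ _

/-- The sum of `γ / (u - w)` at the points `a + x` and `a - x`. -/
def symmQuotient (w : ℝ → ℂ) (γ : ℝ → ℝ) (u : ℂ) (a x : ℝ) : ℂ :=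
  γ (a + x) / (u - w (a + x)) + γ (a - x) / (u - w (a - x))

/-- The sum over all but the zeroth period of `γ / (u - w)` at the points congruent to
`a + x` and `a - x`. -/
def tailKernel (w : ℝ → ℂ) (γ : ℝ → ℝ) (u : ℂ) (a x : ℝ) : ℂ :=
  γ (a + x) * (Complex.cot (u - w (a + x)) - 1 / (u - w (a + x)))
    + γ (a - x) * (Complex.cot (u - w (a - x)) - 1 / (u - w (a - x)))

namespace IsPeriodicCurve

variable {w w' w'' : ℝ → ℂ} {γ : ℝ → ℝ}

/-- The curve grows linearly, so the distance of its far points from `u` does as well. -/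
theorem exists_le_norm_sub (h : IsPeriodicCurve w w' w'') {u : ℂ} {a : ℝ}
    (hu : ∀ y, Real.pi ≤ |y - a| → w y ≠ u) :
    ∃ δ, 0 < δ ∧ ∀ y, Real.pi ≤ |y - a| → δ * |y - a| ≤ ‖u - w y‖ := by
  have hpi := Real.pi_pos
  have hw := h.continuous
  obtain ⟨P, hP, hp⟩ := exists_norm_le_of_periodic (f := fun y : ℝ => w y - (y / 2 : ℝ))
    (by fun_prop) (fun y => by simp only [h.translate]; push_cast; ring) Real.two_pi_pos
  set Q : ℝ := P + ‖u‖ + |a| / 2 with hQ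
  have hQ0 : 0 < Q := by positivity
  set S : Set ℝ := {y | Real.pi ≤ |y - a| ∧ |y - a| ≤ 4 * Q} with hS
  have hSc : IsCompact S := by
    refine Metric.isCompact_of_isClosed_isBounded ?_ ?_
    · have hc : Continuous fun y : ℝ => |y - a| := by fun_prop
      exact (isClosed_le continuous_const hc).inter (isClosed_le hc continuous_const)
    · refine (Metric.isBounded_closedBall (x := a) (r := 4 * Q)).subset fun x hx => ?_
      simpa [Real.dist_eq] using hx.2
  have key : ∃ δ, 0 < δ ∧ ∀ y ∈ S, δ * |y - a| ≤ ‖u - w y‖ := by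
    rcases S.eq_empty_or_nonempty with he | hne
    · exact ⟨1, one_pos, fun q hq => by simp [he] at hq⟩
    · have hx0 : ∀ y ∈ S, 0 < |y - a| := fun y hy => hpi.trans_le hy.1
      have hcont : ContinuousOn (fun y => ‖u - w y‖ / |y - a|) S :=
        (by fun_prop : Continuous fun y => ‖u - w y‖).continuousOn.div (by fun_prop)
          fun y hy => (hx0 y hy).ne'
      obtain ⟨y₀, hy₀, hmin⟩ := hSc.exists_isMinOn hne hcont
      refine ⟨‖u - w y₀‖ / |y₀ - a|, div_pos
        (norm_pos_iff.2 (sub_ne_zero.2 (hu y₀ hy₀.1).symm)) (hx0 _ hy₀), fun y hy => ?_⟩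
      rw [← le_div_iff₀ (hx0 y hy)]
      exact hmin hy
  obtain ⟨δ, hδ, hb⟩ := key
  refine ⟨min δ (1 / 4), by positivity, fun y hy => ?_⟩
  rcases le_or_gt |y - a| (4 * Q) with hle | hlt
  · exact (mul_le_mul_of_nonneg_right (min_le_left _ _) (abs_nonneg _)).trans (hb y ⟨hy, hle⟩)
  · refine (mul_le_mul_of_nonneg_right (min_le_right _ _) (abs_nonneg _)).trans ?_
    have h1 : ((y / 2 : ℝ) : ℂ) = u - (u - w y) - (w y - (y / 2 : ℝ)) := by ring
    have h2 : |y| / 2 ≤ ‖u‖ + ‖u - w y‖ + P := by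
      have h3 : ‖((y / 2 : ℝ) : ℂ)‖ = |y| / 2 := by
        rw [Complex.norm_real, Real.norm_eq_abs, abs_div, abs_two]
      rw [← h3, h1]
      refine (norm_sub_le _ _).trans (add_le_add (norm_sub_le _ _) (hp y))
    have h4 : |y - a| ≤ |y| + |a| := abs_sub _ _
    linarith

/-- The integral over the part of the line at distance at least `π` from `a`, folded to one period:
the sum of `1 / (u - w - jπ)` and `1 / (u - w + jπ)` is `O(1 / j²)`. -/
theorem tendsto_integral_symmQuotient (h : IsPeriodicCurve w w' w'') (hγ : Continuous γ)
    (hper : Function.Periodic γ (2 * Real.pi)) {u : ℂ} {a : ℝ}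
    (hu : ∀ y, Real.pi ≤ |y - a| → w y ≠ u) :
    IntervalIntegrable (tailKernel w γ u a) volume 0 Real.pi ∧
    Tendsto (fun R => ∫ x in Real.pi..R, symmQuotient w γ u a x) atTop
      (𝓝 (∫ x in (0 : ℝ)..Real.pi, tailKernel w γ u a x)) := by
  have hpi := Real.pi_pos
  have hw := h.continuous
  obtain ⟨δ, hδ, hd⟩ := h.exists_le_norm_sub hu
  obtain ⟨B, hB, hb⟩ := exists_norm_le_of_periodic hγ hper Real.two_pi_pos
  have hγn : ∀ (y : ℝ) (n : ℕ), γ (y + n * (2 * Real.pi)) = γ y := fun y n => by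
    simpa using hper.nat_mul n y
  have habs1 : ∀ x, a + x - a = x := fun x => by ring
  have habs2 : ∀ x, |a - x - a| = |x| := fun x => by rw [sub_sub_cancel_left, abs_neg]
  -- lower bounds for the denominators in the sum over the periods
  have hden : ∀ x, |x| ≤ Real.pi → ∀ j : ℕ,
      δ * Real.pi * (j + 1) ≤ ‖u - w (a + x) - (j + 1) * Real.pi‖ ∧
      δ * Real.pi * (j + 1) ≤ ‖u - w (a + x) + (j + 1) * Real.pi‖ := fun x hx j => by
    have hx' := abs_le.1 hx
    have hj : (0 : ℝ) ≤ j := j.cast_nonneg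
    have hjpi : 0 ≤ j * Real.pi := by positivity
    constructor
    · have e := h.translate_nat (a + x) (j + 1)
      have h1 : Real.pi * (j + 1) ≤ |a + x + ((j + 1 : ℕ) : ℝ) * (2 * Real.pi) - a| := by
        push_cast
        refine le_trans ?_ (le_abs_self _)
        linarith
      have h2 := hd _ (le_trans (by nlinarith) h1)
      rw [e] at h2
      refine le_trans ?_ (h2.trans (le_of_eq (congrArg _ (by push_cast; ring))))
      rw [mul_assoc]; gcongr
    · have e := h.translate_int (a + x) (-((j + 1 : ℕ) : ℤ))
      have h1 : Real.pi * (j + 1)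
          ≤ |a + x + ((-((j + 1 : ℕ) : ℤ) : ℤ) : ℝ) * (2 * Real.pi) - a| := by
        push_cast
        refine le_trans ?_ (neg_le_abs _)
        linarith
      have h2 := hd _ (le_trans (by nlinarith) h1)
      rw [e] at h2
      refine le_trans ?_ (h2.trans (le_of_eq (congrArg _ (by push_cast; ring))))
      rw [mul_assoc]; gcongr
  have hne : ∀ x, |x| ≤ Real.pi → ∀ j : ℕ, u - w (a + x) - (j + 1) * Real.pi ≠ 0 ∧
      u - w (a + x) + (j + 1) * Real.pi ≠ 0 := fun x hx j =>
    ⟨norm_pos_iff.1 (lt_of_lt_of_le (by positivity) (hden x hx j).1),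
      norm_pos_iff.1 (lt_of_lt_of_le (by positivity) (hden x hx j).2)⟩
  obtain ⟨V, hV⟩ := (isCompact_Icc (a := -Real.pi) (b := Real.pi)).exists_bound_of_continuousOn
    (f := fun x => u - w (a + x)) (by fun_prop)
  have hV0 : 0 ≤ V := (norm_nonneg _).trans (hV 0 (by constructor <;> linarith))
  set t : ℝ → ℕ → ℂ := fun x j => 1 / (u - w (a + x) - (j + 1) * Real.pi)
    + 1 / (u - w (a + x) + (j + 1) * Real.pi) with ht
  set β : ℕ → ℝ := fun j => 2 * V / (δ * Real.pi) ^ 2 * (1 / ((j : ℝ) + 1) ^ 2) with hβ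
  have hβs : Summable β := by
    refine Summable.mul_left _ ?_
    exact_mod_cast (summable_nat_add_iff 1).2 (Real.summable_one_div_nat_pow.2 one_lt_two)
  have hβ0 : ∀ j, 0 ≤ β j := fun j => by positivity
  have htβ : ∀ x, |x| ≤ Real.pi → ∀ j, ‖t x j‖ ≤ β j := fun x hx j => by
    obtain ⟨n1, n2⟩ := hne x hx j
    obtain ⟨d1, d2⟩ := hden x hx j
    have e : t x j = 2 * (u - w (a + x)) / ((u - w (a + x) - (j + 1) * Real.pi)
        * (u - w (a + x) + (j + 1) * Real.pi)) := by
      simp only [ht]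
      rw [div_add_div _ _ n1 n2]; congr 1; ring
    have e' : β j = 2 * V / ((δ * Real.pi * (j + 1)) * (δ * Real.pi * (j + 1))) := by
      simp only [hβ]; field_simp
    rw [e, e', norm_div, norm_mul, norm_mul, Complex.norm_two]
    gcongr
    exact hV x (abs_le.1 hx)
  set Bs : ℝ := ∑' j, β j with hBs
  have htsum : ∀ x, |x| ≤ Real.pi → ∀ N, ‖∑ j ∈ Finset.range N, t x j‖ ≤ Bs := fun x hx N =>
    (norm_sum_le _ _).trans ((Finset.sum_le_sum fun j _ => htβ x hx j).trans
      (hβs.sum_le_tsum _ fun j _ => hβ0 j))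
  have htlim : ∀ x, |x| ≤ Real.pi → Tendsto (fun N => ∑ j ∈ Finset.range N, t x j) atTop
      (𝓝 (Complex.cot (u - w (a + x)) - 1 / (u - w (a + x)))) := fun x hx =>
    tendsto_sum_cotangent fun n hn he => by
      obtain ⟨m, rfl | rfl⟩ := n.eq_nat_or_neg
      · obtain ⟨j, rfl⟩ := Nat.exists_eq_succ_of_ne_zero (n := m) (by simpa using hn)
        exact (hne x hx j).1 (by rw [he]; push_cast; ring)
      · obtain ⟨j, rfl⟩ := Nat.exists_eq_succ_of_ne_zero (n := m) (by simpa using hn)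
        exact (hne x hx j).2 (by rw [he]; push_cast; ring)
  -- the partial sums of the folded integrand, dominated by a constant
  set F : ℕ → ℝ → ℂ := fun N x => ∑ j ∈ Finset.range N,
    (γ (a + x) * t x j + γ (a - x) * t (-x) j) with hF
  have hFeq : ∀ N x, F N x = γ (a + x) * ∑ j ∈ Finset.range N, t x j
      + γ (a - x) * ∑ j ∈ Finset.range N, t (-x) j := fun N x => by
    simp only [hF, Finset.sum_add_distrib, Finset.mul_sum]
  have hFlim : ∀ x, |x| ≤ Real.pi →
      Tendsto (fun N => F N x) atTop (𝓝 (tailKernel w γ u a x)) := fun x hx => by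
    simp only [hFeq, tailKernel]
    have := htlim (-x) (by rwa [abs_neg])
    rw [← sub_eq_add_neg] at this
    exact ((htlim x hx).const_mul _).add (this.const_mul _)
  have hFb : ∀ N x, |x| ≤ Real.pi → ‖F N x‖ ≤ B * Bs + B * Bs := fun N x hx => by
    rw [hFeq]
    refine (norm_add_le _ _).trans (add_le_add ?_ ?_)
    · rw [norm_mul, Complex.norm_real]; gcongr
      · exact hb _
      · exact htsum x hx N
    · rw [norm_mul, Complex.norm_real]; gcongr
      · exact hb _
      · exact htsum (-x) (by rwa [abs_neg]) N
  have hFm : ∀ N, Measurable (F N) := fun N => by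
    have m1 : Measurable w := hw.measurable
    have m2 : Measurable γ := hγ.measurable
    simp only [hF, ht]
    fun_prop
  have habs : ∀ x ∈ Set.Ioc 0 Real.pi, |x| ≤ Real.pi := fun x hx => by
    rw [abs_of_pos hx.1]; exact hx.2
  have hmt : Measurable (tailKernel w γ u a) := by
    have m2 : Measurable γ := hγ.measurable
    have m3 : ∀ f : ℝ → ℝ, Continuous f → Measurable fun x => Complex.cot (u - w (f x)) :=
      fun f hf => (Complex.continuous_cos.comp (by fun_prop)).measurable.div
        (Complex.continuous_sin.comp (by fun_prop)).measurable
    have m4 := m3 (fun x => a + x) (by fun_prop)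
    have m5 := m3 (fun x => a - x) (by fun_prop)
    have m1 : Measurable w := hw.measurable
    unfold tailKernel
    fun_prop
  refine ⟨intervalIntegrable_of_bound hpi.le hmt.aestronglyMeasurable fun x hx =>
    le_of_tendsto (hFlim x (habs x hx)).norm
      (Eventually.of_forall fun N => hFb N x (habs x hx)), ?_⟩
  have hlim : Tendsto (fun N => ∫ x in (0 : ℝ)..Real.pi, F N x) atTop
      (𝓝 (∫ x in (0 : ℝ)..Real.pi, tailKernel w γ u a x)) := by
    refine intervalIntegral.tendsto_integral_filter_of_dominated_convergence
      (fun _ => B * Bs + B * Bs) (Eventually.of_forall fun N => (hFm N).aestronglyMeasurable)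
      (Eventually.of_forall fun N => Eventually.of_forall fun x hx => ?_)
      intervalIntegrable_const (Eventually.of_forall fun x hx => ?_)
    all_goals rw [Set.uIoc_of_le hpi.le] at hx
    · exact hFb N x (habs x hx)
    · exact hFlim x (habs x hx)
  have hsc : ContinuousOn (symmQuotient w γ u a) (Set.Ici Real.pi) := by
    unfold symmQuotient
    refine ContinuousOn.add (ContinuousOn.div (by fun_prop) (by fun_prop) fun x hx => ?_)
      (ContinuousOn.div (by fun_prop) (by fun_prop) fun x hx => ?_)
    · refine sub_ne_zero.2 (hu _ ?_).symm
      rw [habs1]; exact le_trans hx (le_abs_self x)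
    · refine sub_ne_zero.2 (hu _ ?_).symm
      rw [habs2]; exact le_trans hx (le_abs_self x)
  have hint : ∀ b c, Real.pi ≤ b → Real.pi ≤ c →
      IntervalIntegrable (symmQuotient w γ u a) volume b c :=
    fun b c hb hc => (hsc.mono fun x hx => le_trans (le_min hb hc) hx.1).intervalIntegrable
  refine tendsto_integral_of_tendsto_odd (C := B / δ + B / δ) hsc (fun x hx => ?_) ?_
  · have hx0 : 0 < x := hpi.trans_le hx
    have h1 := hd (a + x) (by rw [habs1, abs_of_pos hx0]; exact hx)
    have h2 := hd (a - x) (by rw [habs2, abs_of_pos hx0]; exact hx)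
    rw [habs1, abs_of_pos hx0] at h1
    rw [habs2, abs_of_pos hx0] at h2
    have e : (B / δ + B / δ) / x = B / (δ * x) + B / (δ * x) := by field_simp
    rw [e]
    refine (norm_add_le _ _).trans (add_le_add ?_ ?_)
    · rw [norm_div, Complex.norm_real]; gcongr; exact hb _
    · rw [norm_div, Complex.norm_real]; gcongr; exact hb _
  · refine hlim.congr fun N => ?_
    -- the `N`-th step adds the integral over the period centred at `(N + 1) 2π`
    induction N with
    | zero => simp [hF]
    | succ N ih =>
      have hN : (0 : ℝ) ≤ N := N.cast_nonneg
      have hNpi : 0 ≤ N * Real.pi := by positivity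
      have c1 : (2 * (N : ℝ) + 1) * Real.pi = (N + 1) * (2 * Real.pi) - Real.pi := by ring
      have c2 : (2 * ((N + 1 : ℕ) : ℝ) + 1) * Real.pi = (N + 1) * (2 * Real.pi) + Real.pi := by
        push_cast; ring
      have i0 : Real.pi ≤ (2 * (N : ℝ) + 1) * Real.pi := by linarith
      have i1 : Real.pi ≤ (2 * ((N + 1 : ℕ) : ℝ) + 1) * Real.pi := by push_cast; linarith
      have i2 : Real.pi ≤ (N + 1) * (2 * Real.pi) := by linarith
      rw [← intervalIntegral.integral_add_adjacent_intervals (hint _ _ le_rfl i0) (hint _ _ i0 i1),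
        ← ih, c1, c2, integral_symmetrize (hint _ _ (c1 ▸ i0) i2) (hint _ _ i2 (c2 ▸ i1)),
        ← intervalIntegral.integral_add]
      · refine intervalIntegral.integral_congr fun x hx => ?_
        have hs : F (N + 1) x = F N x + (γ (a + x) * t x N + γ (a - x) * t (-x) N) := by
          simp only [hF, Finset.sum_range_succ]
        rw [hs, symmQuotient, symmQuotient]
        have p1 := h.translate_nat (a + x) (N + 1)
        have p2 := h.translate_nat (a - x) (N + 1)
        have p3 := h.translate_int (a + x) (-((N + 1 : ℕ) : ℤ))
        have p4 := h.translate_int (a - x) (-((N + 1 : ℕ) : ℤ))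
        have q1 := hγn (a + x) (N + 1)
        have q2 := hγn (a - x) (N + 1)
        have q3 := hγn (a + x - (N + 1) * (2 * Real.pi)) (N + 1)
        have q4 := hγn (a - x - (N + 1) * (2 * Real.pi)) (N + 1)
        push_cast at p1 p2 p3 p4 q1 q2 q3 q4
        rw [sub_add_cancel] at q3 q4
        rw [show a + (((N : ℝ) + 1) * (2 * Real.pi) + x)
            = a + x + ((N : ℝ) + 1) * (2 * Real.pi) by ring,
          show a - (((N : ℝ) + 1) * (2 * Real.pi) + x)
            = a - x - ((N : ℝ) + 1) * (2 * Real.pi) by ring,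
          show a + (((N : ℝ) + 1) * (2 * Real.pi) - x)
            = a - x + ((N : ℝ) + 1) * (2 * Real.pi) by ring,
          show a - (((N : ℝ) + 1) * (2 * Real.pi) - x)
            = a + x - ((N : ℝ) + 1) * (2 * Real.pi) by ring]
        rw [neg_mul, ← sub_eq_add_neg] at p3 p4
        rw [p1, p2, p3, p4, q1, q2, ← q3, ← q4]
        simp only [ht, ← sub_eq_add_neg]
        ring
      · exact intervalIntegrable_of_bound hpi.le (hFm N).aestronglyMeasurable
          fun x hx => hFb N x (habs x hx)
      · have := intervalIntegrable_symmetrize (hint _ _ (c1 ▸ i0) i2) (hint _ _ i2 (c2 ▸ i1))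
        exact this.1.add this.2

end IsPeriodicCurve

/-! ### Principal values and velocities as integrals over one period -/

/-- The truncated integral as an integral over the distance to the singularity. -/
theorem truncatedIntegral_eq {f : ℝ → ℂ} {a ε R : ℝ} (hε : 0 < ε) (hεR : ε < R)
    (hf : ContinuousOn f {a}ᶜ) :
    truncatedIntegral f a (ε, R) = ∫ x in ε..R, (f (a + x) + f (a - x)) := by
  have hset : {x : ℝ | ε < |x - a| ∧ |x - a| < R}
      = Set.Ioo (a + ε) (a + R) ∪ Set.Ioo (a - R) (a - ε) := by
    ext x
    simp only [Set.mem_ofPred_eq, Set.mem_union, Set.mem_Ioo, lt_abs, abs_lt]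
    constructor
    · rintro ⟨h1 | h1, h2, h3⟩
      · left; constructor <;> linarith
      · right; constructor <;> linarith
    · rintro (⟨h1, h2⟩ | ⟨h1, h2⟩)
      · exact ⟨Or.inl (by linarith), by linarith, by linarith⟩
      · exact ⟨Or.inr (by linarith), by linarith, by linarith⟩
  have hdisj : Disjoint (Set.Ioo (a + ε) (a + R)) (Set.Ioo (a - R) (a - ε)) :=
    Set.disjoint_left.2 fun x h1 h2 => by linarith [h1.1, h2.2]
  have i1 : IntervalIntegrable f volume (a + ε) (a + R) :=
    (hf.mono fun x hx hxa => by
      rw [Set.uIcc_of_le (by linarith)] at hx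
      have : x = a := hxa
      linarith [hx.1]).intervalIntegrable
  have i2 : IntervalIntegrable f volume (a - R) (a - ε) :=
    (hf.mono fun x hx hxa => by
      rw [Set.uIcc_of_le (by linarith)] at hx
      have : x = a := hxa
      linarith [hx.2]).intervalIntegrable
  have j1 : IntervalIntegrable (fun x => f (a + x)) volume ε R := by
    simpa using i1.comp_add_left a
  have j2 : IntervalIntegrable (fun x => f (a - x)) volume ε R := by
    simpa using (i2.comp_sub_left a).symm
  rw [truncatedIntegral]
  simp only
  rw [hset, setIntegral_union hdisj measurableSet_Ioo
    (((intervalIntegrable_iff_integrableOn_Ioc_of_le (by linarith)).1 i1).mono_set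
      Set.Ioo_subset_Ioc_self)
    (((intervalIntegrable_iff_integrableOn_Ioc_of_le (by linarith)).1 i2).mono_set
      Set.Ioo_subset_Ioc_self),
    ← integral_Ioc_eq_integral_Ioo, ← integral_Ioc_eq_integral_Ioo,
    ← intervalIntegral.integral_of_le (by linarith),
    ← intervalIntegral.integral_of_le (by linarith), intervalIntegral.integral_add j1 j2,
    intervalIntegral.integral_comp_add_left, intervalIntegral.integral_comp_sub_left]

theorem symmQuotient_add_tailKernel (w : ℝ → ℂ) (γ : ℝ → ℝ) (u : ℂ) (a x : ℝ) :
    symmQuotient w γ u a x + tailKernel w γ u a x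
      = γ (a + x) * Complex.cot (u - w (a + x)) + γ (a - x) * Complex.cot (u - w (a - x)) := by
  rw [symmQuotient, tailKernel]; ring

theorem cot_neg (v : ℂ) : Complex.cot (-v) = -Complex.cot v := by
  simp [Complex.cot, div_neg]

theorem cot_add_pi (v : ℂ) : Complex.cot (v + Real.pi) = Complex.cot v := by
  simp [Complex.cot, Complex.cos_add_pi, Complex.sin_add_pi, neg_div_neg_eq]

namespace IsPeriodicCurve

variable {w w' w'' : ℝ → ℂ} {γ : ℝ → ℝ}

/-- The principal value over the line as an absolutely convergent integral over half a period. -/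
theorem hasPV_kernel (h : IsPeriodicCurve w w' w'') (hγ : ContDiff ℝ 1 γ)
    (hper : Function.Periodic γ (2 * Real.pi)) (a : ℝ) :
    HasPV (kernel w γ a) a
      (-(1 / w' a) * ∫ x in (0 : ℝ)..Real.pi, symmKernel w w' γ a x) := by
  have hpi := Real.pi_pos
  have hw := h.continuous
  have hγc := hγ.continuous
  have hreg := h.regular a
  have hu : ∀ y, y ≠ a → w y ≠ w a := fun y hy he => hy (h.injective he)
  obtain ⟨hti, htl⟩ := h.tendsto_integral_symmQuotient hγc hper (u := w a) (a := a)
    fun y hy => hu y fun hya => by rw [hya, sub_self, abs_zero] at hy; linarith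
  have hkc : ContinuousOn (kernel w γ a) {a}ᶜ := by
    unfold kernel
    exact ContinuousOn.div (by fun_prop) (by fun_prop)
      fun x hx => sub_ne_zero.2 (hu x hx).symm
  have hsum : ∀ x, symmQuotient w γ (w a) a x
      = -(1 / w' a) * symmKernel w w' γ a x - tailKernel w γ (w a) a x := fun x => by
    rw [eq_sub_iff_add_eq, symmQuotient_add_tailKernel, symmKernel, cotKernel, cotKernel,
      increment, increment, ← sub_eq_add_neg, ← neg_sub (w (a + x)), ← neg_sub (w (a - x)),
      cot_neg, cot_neg]
    field_simp
    ring
  have hsi : IntervalIntegrable (symmQuotient w γ (w a) a) volume 0 Real.pi := by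
    rw [show symmQuotient w γ (w a) a = fun x => -(1 / w' a) * symmKernel w w' γ a x
      - tailKernel w γ (w a) a x from funext hsum]
    exact ((h.intervalIntegrable_symmKernel hγ hper a).const_mul _).sub hti
  have hlim : Tendsto (fun ε => ∫ x in ε..Real.pi, symmQuotient w γ (w a) a x) (𝓝[>] 0)
      (𝓝 (∫ x in (0 : ℝ)..Real.pi, symmQuotient w γ (w a) a x)) := by
    have hc := intervalIntegral.continuousOn_primitive_interval_left
      (intervalIntegrable_iff_integrableOn_Icc_of_le hpi.le |>.1 hsi |> fun hI => by
        rwa [← Set.uIcc_of_le hpi.le] at hI)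
    have := hc 0 (Set.left_mem_uIcc)
    rw [Set.uIcc_of_le hpi.le] at this
    exact this.tendsto.mono_left (nhdsWithin_le_of_mem
      (mem_of_superset (Ioo_mem_nhdsGT hpi) Set.Ioo_subset_Icc_self))
  have hval : -(1 / w' a) * ∫ x in (0 : ℝ)..Real.pi, symmKernel w w' γ a x
      = (∫ x in (0 : ℝ)..Real.pi, symmQuotient w γ (w a) a x)
        + ∫ x in (0 : ℝ)..Real.pi, tailKernel w γ (w a) a x := by
    rw [← intervalIntegral.integral_add hsi hti, ← intervalIntegral.integral_const_mul]
    congr 1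
    funext x
    rw [hsum]; ring
  rw [HasPV, hval]
  refine ((hlim.comp tendsto_fst).add (htl.comp tendsto_snd)).congr' ?_
  filter_upwards [prod_mem_prod (Ioo_mem_nhdsGT hpi) (Ioi_mem_atTop Real.pi)] with p hp
  obtain ⟨⟨h1, h2⟩, h3⟩ := hp
  have h3 : Real.pi < p.2 := h3
  have hint : ∀ b c, 0 < b → b ≤ c → IntervalIntegrable (symmQuotient w γ (w a) a) volume b c :=
    fun b c hb hbc => by
      refine ContinuousOn.intervalIntegrable ?_
      rw [Set.uIcc_of_le hbc]
      unfold symmQuotient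
      refine ContinuousOn.add (ContinuousOn.div (by fun_prop) (by fun_prop) fun x hx => ?_)
        (ContinuousOn.div (by fun_prop) (by fun_prop) fun x hx => ?_)
      · exact sub_ne_zero.2 (hu _ (by linarith [hx.1])).symm
      · exact sub_ne_zero.2 (hu _ (by linarith [hx.1])).symm
  rw [truncatedIntegral_eq h1 (h2.trans h3) hkc]
  exact intervalIntegral.integral_add_adjacent_intervals (hint _ _ h1 h2.le) (hint _ _ hpi h3.le)

/-- The conditionally convergent velocity integral at a point `u` off the curve as an integral
over one period. -/
theorem tendsto_velocity (h : IsPeriodicCurve w w' w'') (hγ : Continuous γ)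
    (hper : Function.Periodic γ (2 * Real.pi)) {u : ℂ} (hu : ∀ y, w y ≠ u) :
    Tendsto (fun R => ∫ x in (-R)..R, (γ x : ℂ) / (u - w x)) atTop
      (𝓝 (∫ x in (0 : ℝ)..Real.pi,
        (γ x * Complex.cot (u - w x) + γ (-x) * Complex.cot (u - w (-x))))) := by
  have hw := h.continuous
  obtain ⟨hti, htl⟩ := h.tendsto_integral_symmQuotient hγ hper (u := u) (a := 0) fun y _ => hu y
  have hc : Continuous fun x => (γ x : ℂ) / (u - w x) :=
    Continuous.div (by fun_prop) (by fun_prop) fun x => sub_ne_zero.2 (hu x).symm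
  have hs : symmQuotient w γ u 0 = fun x => (γ (0 + x) : ℂ) / (u - w (0 + x))
    + (γ (0 - x) : ℂ) / (u - w (0 - x)) := rfl
  have hsc : Continuous (symmQuotient w γ u 0) := by
    rw [hs]
    exact (hc.comp (continuous_const.add continuous_id)).add
      (hc.comp (continuous_const.sub continuous_id))
  have hval : ∫ x in (0 : ℝ)..Real.pi,
      (γ x * Complex.cot (u - w x) + γ (-x) * Complex.cot (u - w (-x)))
      = (∫ x in (0 : ℝ)..Real.pi, symmQuotient w γ u 0 x)
        + ∫ x in (0 : ℝ)..Real.pi, tailKernel w γ u 0 x := by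
    rw [← intervalIntegral.integral_add (hsc.intervalIntegrable _ _) hti]
    congr 1
    funext x
    rw [symmQuotient_add_tailKernel, zero_add, zero_sub]
  rw [hval]
  refine (htl.const_add _).congr fun R => ?_
  rw [intervalIntegral.integral_add_adjacent_intervals (hsc.intervalIntegrable _ _)
    (hsc.intervalIntegrable _ _), hs, ← integral_symmetrize
    (s := fun x => (γ x : ℂ) / (u - w x)) (hc.intervalIntegrable _ _) (hc.intervalIntegrable _ _),
    zero_sub, zero_add]

end IsPeriodicCurve

/-! ### The renormalized curve -/

theorem mean_mul_two_pi (f : ℝ → ℝ) :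
    ∫ a in (0 : ℝ)..(2 * Real.pi), f a = 2 * Real.pi * mean f := by
  have := Real.pi_ne_zero
  rw [mean]; field_simp

/-- The constant `M / (2π mean(cos θ))`, which scales the renormalized curve to period `M`. -/
def renormScale (M : ℝ) (θ : ℝ → ℝ) : ℝ := M / (2 * Real.pi * mean (fun b => Real.cos (θ b)))

/-- The derivative of the renormalized curve. -/
def renormDeriv (M : ℝ) (θ : ℝ → ℝ) (a : ℝ) : ℂ :=
  renormScale M θ *
    (Complex.exp (Complex.I * (θ a : ℂ)) - Complex.I * (mean (fun b => Real.sin (θ b)) : ℂ))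

theorem exp_I_mul (x : ℝ) :
    Complex.exp (Complex.I * (x : ℂ)) = Real.cos x + Real.sin x * Complex.I := by
  rw [mul_comm, Complex.exp_mul_I]; simp

theorem norm_exp_I_mul (x : ℝ) : ‖Complex.exp (Complex.I * (x : ℂ))‖ = 1 := by
  rw [mul_comm]; exact Complex.norm_exp_ofReal_mul_I x

theorem integral_exp_I_mul {θ : ℝ → ℝ} (hθ : Continuous θ) :
    ∫ b in (0 : ℝ)..(2 * Real.pi), Complex.exp (Complex.I * (θ b : ℂ))
      = 2 * Real.pi * (mean (fun b => Real.cos (θ b))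
        + mean (fun b => Real.sin (θ b)) * Complex.I) := by
  simp_rw [exp_I_mul]
  have c1 : Continuous fun b => ((Real.cos (θ b) : ℝ) : ℂ) :=
    Complex.continuous_ofReal.comp (Real.continuous_cos.comp hθ)
  have c2 : Continuous fun b => ((Real.sin (θ b) : ℝ) : ℂ) :=
    Complex.continuous_ofReal.comp (Real.continuous_sin.comp hθ)
  have c3 : Continuous fun b => ((Real.sin (θ b) : ℝ) : ℂ) * Complex.I := c2.mul continuous_const
  rw [intervalIntegral.integral_add (c1.intervalIntegrable _ _) (c3.intervalIntegrable _ _),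
    intervalIntegral.integral_mul_const,
    intervalIntegral.integral_ofReal, intervalIntegral.integral_ofReal, mean_mul_two_pi,
    mean_mul_two_pi]
  push_cast
  ring

/-- The mean of `e^{iθ}` lies in the unit disc, and its real part does not vanish. -/
theorem mean_sin_sq_lt_one {θ : ℝ → ℝ} (hθ : Continuous θ)
    (hcos : 0 < mean (fun a => Real.cos (θ a))) : mean (fun a => Real.sin (θ a)) ^ 2 < 1 := by
  have hpi := Real.pi_pos
  have h1 := intervalIntegral.norm_integral_le_of_norm_le_const (a := 0) (b := 2 * Real.pi)
    (f := fun b => Complex.exp (Complex.I * (θ b : ℂ))) (C := 1)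
    fun x _ => (norm_exp_I_mul _).le
  rw [integral_exp_I_mul hθ, norm_mul, sub_zero, abs_of_pos Real.two_pi_pos, one_mul,
    show (2 * Real.pi : ℂ) = ((2 * Real.pi : ℝ) : ℂ) by push_cast; rfl, Complex.norm_real,
    Real.norm_of_nonneg Real.two_pi_pos.le] at h1
  have h2 : ‖(mean (fun b => Real.cos (θ b)) : ℂ) + mean (fun b => Real.sin (θ b)) * Complex.I‖
      ≤ 1 := le_of_mul_le_mul_left (by rwa [mul_one]) Real.two_pi_pos
  rw [Complex.norm_add_mul_I, Real.sqrt_le_one] at h2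
  nlinarith

theorem exp_sub_ne_zero {t : ℝ} (ht : t ^ 2 < 1) (x : ℝ) :
    Complex.exp (Complex.I * (x : ℂ)) - Complex.I * (t : ℂ) ≠ 0 := fun h => by
  have := norm_exp_I_mul x
  rw [sub_eq_zero.1 h, norm_mul, Complex.norm_I, one_mul, Complex.norm_real, Real.norm_eq_abs]
    at this
  rw [← sq_abs, this] at ht
  norm_num at ht

section

variable {M : ℝ} {θ : ℝ → ℝ}

theorem renormScale_pos (hM : 0 < M) (hcos : 0 < mean (fun a => Real.cos (θ a))) :
    0 < renormScale M θ := by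
  have := Real.pi_pos
  unfold renormScale; positivity

theorem renormDeriv_ne_zero (hM : 0 < M) (hθ : Continuous θ)
    (hcos : 0 < mean (fun a => Real.cos (θ a))) (a : ℝ) : renormDeriv M θ a ≠ 0 :=
  mul_ne_zero (by exact_mod_cast (renormScale_pos hM hcos).ne')
    (exp_sub_ne_zero (mean_sin_sq_lt_one hθ hcos) _)

theorem hasDerivAt_renormCurve (M : ℝ) (hθ : Continuous θ) (a : ℝ) :
    HasDerivAt (renormCurve M θ) (renormDeriv M θ a) a := by
  have hc : Continuous fun b => Complex.exp (Complex.I * (θ b : ℂ)) := by fun_prop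
  have h1 := hc.integral_hasStrictDerivAt 0 a |>.hasDerivAt
  have h2 := ((Complex.ofRealCLM.hasDerivAt (x := a)).const_mul Complex.I).mul_const
    (mean (fun b => Real.sin (θ b)) : ℂ)
  refine ((h1.sub h2).const_mul
    (((M / (2 * Real.pi * mean (fun b => Real.cos (θ b))) : ℝ) : ℂ))).congr_deriv ?_
  simp [renormDeriv, renormScale]

theorem renormCurve_translate (M : ℝ) (hθ : Continuous θ)
    (hθper : Function.Periodic θ (2 * Real.pi)) (hcos : 0 < mean (fun a => Real.cos (θ a)))
    (a : ℝ) : renormCurve M θ (a + 2 * Real.pi) = renormCurve M θ a + M := by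
  have hper : Function.Periodic (fun b => Complex.exp (Complex.I * (θ b : ℂ)))
    (2 * Real.pi) := fun b => by simp only [hθper b]
  have hc : Continuous fun b => Complex.exp (Complex.I * (θ b : ℂ)) := by fun_prop
  have h1 := hper.intervalIntegral_add_eq_add 0 a fun _ _ => hc.intervalIntegrable _ _
  rw [zero_add] at h1
  have hm : (mean (fun a => Real.cos (θ a)) : ℂ) ≠ 0 := by exact_mod_cast hcos.ne'
  have hpi : (Real.pi : ℂ) ≠ 0 := by exact_mod_cast Real.pi_ne_zero
  rw [renormCurve, renormCurve, h1, integral_exp_I_mul hθ]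
  push_cast
  field_simp
  ring

/-- The renormalized curve, scaled to period `π`. -/
theorem isPeriodicCurve_renormCurve (hM : 0 < M) (hθ : ContDiff ℝ 2 θ)
    (hθper : Function.Periodic θ (2 * Real.pi)) (hcos : 0 < mean (fun a => Real.cos (θ a)))
    (hinj : Function.Injective (renormCurve M θ)) :
    IsPeriodicCurve (fun a => ((Real.pi / M : ℝ) : ℂ) * renormCurve M θ a)
      (fun a => ((Real.pi / M : ℝ) : ℂ) * renormDeriv M θ a)
      (fun a => ((Real.pi / M : ℝ) : ℂ) * (renormScale M θ *
        (Complex.exp (Complex.I * (θ a : ℂ)) * (Complex.I * ((deriv θ a : ℝ) : ℂ))))) := by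
  have hpi := Real.pi_pos
  have hk : ((Real.pi / M : ℝ) : ℂ) ≠ 0 := by
    exact_mod_cast (div_pos hpi hM).ne'
  have hc := hθ.continuous
  have hd1 : ∀ a, HasDerivAt θ (deriv θ a) a := fun a =>
    (hθ.differentiable two_ne_zero a).hasDerivAt
  have hθ' : ContDiff ℝ 1 (deriv θ) := hθ.deriv'
  have hd2 : ∀ a, HasDerivAt (deriv θ) (deriv (deriv θ) a) a := fun a =>
    (hθ'.differentiable one_ne_zero a).hasDerivAt
  have hper1 : Function.Periodic (deriv θ) (2 * Real.pi) := fun a => by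
    rw [← deriv_comp_add_const, show (fun x => θ (x + 2 * Real.pi)) = θ from funext hθper]
  have hper2 : Function.Periodic (deriv (deriv θ)) (2 * Real.pi) := fun a => by
    rw [← deriv_comp_add_const,
      show (fun x => deriv θ (x + 2 * Real.pi)) = deriv θ from funext hper1]
  have hexp : ∀ a, HasDerivAt (fun b => Complex.exp (Complex.I * (θ b : ℂ)))
      (Complex.exp (Complex.I * (θ a : ℂ)) * (Complex.I * ((deriv θ a : ℝ) : ℂ))) a := fun a =>
    ((hd1 a).ofReal_comp.const_mul Complex.I).cexp
  refine ⟨fun a => (hasDerivAt_renormCurve M hc a).const_mul _,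
    fun a => (((hexp a).sub_const _).const_mul _).const_mul _, ?_, fun a => ?_,
    fun a => mul_ne_zero hk (renormDeriv_ne_zero hM hc hcos a),
    fun a b hab => hinj (mul_left_cancel₀ hk hab)⟩
  · have hd3 := fun a => ((hexp a).mul
      ((hd2 a).ofReal_comp.const_mul Complex.I)).const_mul (renormScale M θ : ℂ)
        |>.const_mul ((Real.pi / M : ℝ) : ℂ)
    have c1 := hθ'.continuous
    have c2 := hθ'.continuous_deriv le_rfl
    obtain ⟨C, -, hC⟩ := exists_norm_le_of_periodic (f := fun a => ((Real.pi / M : ℝ) : ℂ) *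
      ((renormScale M θ : ℂ) * (Complex.exp (Complex.I * (θ a : ℂ))
        * (Complex.I * ((deriv θ a : ℝ) : ℂ))
        * (Complex.I * ((deriv θ a : ℝ) : ℂ)) + Complex.exp (Complex.I * (θ a : ℂ))
        * (Complex.I * ((deriv (deriv θ) a : ℝ) : ℂ))))) (by fun_prop)
      (fun a => by simp only [hθper a, hper1 a, hper2 a]) Real.two_pi_pos
    exact ⟨C, norm_sub_le_of_hasDerivAt hd3 hC⟩
  · rw [renormCurve_translate M hc hθper hcos]
    have : (M : ℂ) ≠ 0 := by exact_mod_cast hM.ne'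
    push_cast
    field_simp

end

/-! ### The mean slope of the curve -/

theorem norm_exp_sub_sq (t x : ℝ) :
    ‖Complex.exp (Complex.I * (x : ℂ)) - Complex.I * (t : ℂ)‖ ^ 2
      = 1 - 2 * t * Real.sin x + t ^ 2 := by
  have e : Complex.exp (Complex.I * (x : ℂ)) - Complex.I * (t : ℂ)
      = (Real.cos x : ℂ) + ((Real.sin x - t : ℝ) : ℂ) * Complex.I := by
    rw [exp_I_mul]; push_cast; ring
  rw [e, ← Complex.normSq_eq_norm_sq, Complex.normSq_add_mul_I]
  have := Real.sin_sq_add_cos_sq x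
  linarith

/-- With `r = (1 - 2ts + t²)^{1/2}`, the concave function `s r` of `s` (for `0 < t < 1`) lies above
its chord `s - t` over `[-1, 1]`. The estimate is multiplied by `t (r + 1)`, which makes it
quantitative and independent of the sign of `t`. -/
theorem chord_le {t s r : ℝ} (hs : s ^ 2 ≤ 1) (hr : 0 ≤ r)
    (hr2 : r ^ 2 = 1 - 2 * t * s + t ^ 2) :
    t ^ 2 * (2 * (1 - s ^ 2)) ≤ (r + 1) * (t * (s * r) - t * s + t ^ 2) := by
  have h1 : 1 - t * s ≤ r := abs_le_of_sq_le_sq' (by nlinarith [sq_nonneg t]) hr |>.2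
  have h2 : (r + 1) * (t * (s * r) - t * s + t ^ 2) = t ^ 2 * (t * s - 2 * s ^ 2 + r + 1) := by
    linear_combination t * s * hr2
  rw [h2]
  gcongr
  linarith

/-- If the integral of `sin θ |e^{iθ} - it|` with `t = mean (sin θ)` vanishes, then so does `t`: by
`chord_le` the integral of `t (sin θ |e^{iθ} - it| - sin θ + t)` is positive otherwise, as
`sin θ = ±1` cannot hold everywhere. -/
theorem mean_sin_eq_zero {θ : ℝ → ℝ} (hθ : Continuous θ)
    (hcos : 0 < mean (fun a => Real.cos (θ a)))
    (h : ∫ a in (0 : ℝ)..(2 * Real.pi), Real.sin (θ a) * ‖Complex.exp (Complex.I * (θ a : ℂ))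
      - Complex.I * (mean (fun b => Real.sin (θ b)) : ℂ)‖ = 0) :
    mean (fun a => Real.sin (θ a)) = 0 := by
  have hI := mean_mul_two_pi (fun a => Real.sin (θ a))
  set t := mean (fun a => Real.sin (θ a)) with htdef
  by_contra ht0
  set r : ℝ → ℝ := fun a => ‖Complex.exp (Complex.I * (θ a : ℂ)) - Complex.I * (t : ℂ)‖ with hr
  have hrc : Continuous r := by fun_prop
  have hb : ∀ a, t ^ 2 * (2 * (1 - Real.sin (θ a) ^ 2))
      ≤ (r a + 1) * (t * (Real.sin (θ a) * r a) - t * Real.sin (θ a) + t ^ 2) := fun a =>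
    chord_le (Real.sin_sq_le_one _) (norm_nonneg _) (norm_exp_sub_sq _ _)
  have hr1 : ∀ a, 0 < r a + 1 := fun a => by positivity
  have key : 0 < ∫ a in (0 : ℝ)..(2 * Real.pi),
      (t * (Real.sin (θ a) * r a) - t * Real.sin (θ a) + t ^ 2) := by
    refine intervalIntegral.integral_pos Real.two_pi_pos (by fun_prop) (fun a _ => ?_) ?_
    · refine nonneg_of_mul_nonneg_right ((?_ : (0 : ℝ) ≤ _).trans (hb a)) (hr1 a)
      have := Real.sin_sq_le_one (θ a)
      have : 0 ≤ 1 - Real.sin (θ a) ^ 2 := by linarith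
      positivity
    · have hex : ∃ a ∈ Set.Icc 0 (2 * Real.pi), Real.cos (θ a) ≠ 0 := by
        by_contra! hall
        have : mean (fun a => Real.cos (θ a)) = 0 := by
          rw [mean, intervalIntegral.integral_congr (g := fun _ => 0) fun a ha => ?_]
          · simp
          · rw [Set.uIcc_of_le Real.two_pi_pos.le] at ha
            exact hall a ha
        exact hcos.ne' this
      obtain ⟨a, ha, hne⟩ := hex
      refine ⟨a, ha, (mul_pos_iff_of_pos_left (hr1 a)).1 ((?_ : (0 : ℝ) < _).trans_le (hb a))⟩
      have : 1 - Real.sin (θ a) ^ 2 = Real.cos (θ a) ^ 2 := by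
        rw [← Real.sin_sq_add_cos_sq (θ a)]; ring
      rw [this]
      positivity
  have i1 : IntervalIntegrable (fun a => t * (Real.sin (θ a) * r a)) volume 0 (2 * Real.pi) :=
    Continuous.intervalIntegrable (by fun_prop) _ _
  have i2 : IntervalIntegrable (fun a => t * Real.sin (θ a)) volume 0 (2 * Real.pi) :=
    Continuous.intervalIntegrable (by fun_prop) _ _
  rw [intervalIntegral.integral_add (i1.sub i2) intervalIntegrable_const,
    intervalIntegral.integral_sub i1 i2, intervalIntegral.integral_const_mul,
    intervalIntegral.integral_const_mul, h, hI, intervalIntegral.integral_const, smul_eq_mul] at key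
  linarith

/-! ### The Birkhoff-Rott integral of the renormalized curve -/

theorem HasPV.pv_eq {f : ℝ → ℂ} {a : ℝ} {l : ℂ} (h : HasPV f a l) : pv f a = l :=
  Tendsto.limUnder_eq h

theorem HasPV.const_mul {f : ℝ → ℂ} {a : ℝ} {l : ℂ} (h : HasPV f a l) (k : ℂ) :
    HasPV (fun x => k * f x) a (k * l) := by
  have e : truncatedIntegral (fun x => k * f x) a = fun p => k * truncatedIntegral f a p := by
    funext p
    exact integral_const_mul k _
  rw [HasPV, e]
  exact Tendsto.const_mul k h

theorem kernel_add_const (w : ℝ → ℂ) (γ : ℝ → ℝ) (k : ℂ) (a : ℝ) :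
    kernel (fun b => w b + k) γ a = kernel w γ a := by
  funext x
  simp [kernel]

theorem birkhoffRott_add_const (w : ℝ → ℂ) (γ : ℝ → ℝ) (k : ℂ) (a : ℝ) :
    birkhoffRott (fun b => w b + k) γ a = birkhoffRott w γ a := by
  rw [birkhoffRott, birkhoffRott, kernel_add_const]

theorem unitTangent_add_const (w : ℝ → ℂ) (k : ℂ) :
    unitTangent (fun b => w b + k) = unitTangent w := by
  funext a
  rw [unitTangent, unitTangent, deriv_add_const]

/-- The absolutely convergent integral to which the principal value on the renormalized curve
reduces. -/
def renormIntegral (M : ℝ) (θ γ : ℝ → ℝ) (a : ℝ) : ℂ :=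
  ∫ x in (0 : ℝ)..Real.pi, symmKernel (fun b => ((Real.pi / M : ℝ) : ℂ) * renormCurve M θ b)
    (fun b => ((Real.pi / M : ℝ) : ℂ) * renormDeriv M θ b) γ a x

section

variable {M : ℝ} {θ γ : ℝ → ℝ}

theorem hasPV_kernel_renormCurve (hM : 0 < M) (hθ : ContDiff ℝ 2 θ) (hγ : ContDiff ℝ 1 γ)
    (hθper : Function.Periodic θ (2 * Real.pi)) (hγper : Function.Periodic γ (2 * Real.pi))
    (hcos : 0 < mean (fun a => Real.cos (θ a)))
    (hinj : Function.Injective (renormCurve M θ)) (a : ℝ) :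
    HasPV (kernel (renormCurve M θ) γ a) a
      (-(1 / renormDeriv M θ a) * renormIntegral M θ γ a) := by
  have h := (isPeriodicCurve_renormCurve hM hθ hθper hcos hinj).hasPV_kernel hγ hγper a
  have hk : ((Real.pi / M : ℝ) : ℂ) ≠ 0 := by
    exact_mod_cast (div_pos Real.pi_pos hM).ne'
  have h2 := h.const_mul ((Real.pi / M : ℝ) : ℂ)
  have hne := renormDeriv_ne_zero hM hθ.continuous hcos a
  have e1 : (fun x => ((Real.pi / M : ℝ) : ℂ)
      * kernel (fun b => ((Real.pi / M : ℝ) : ℂ) * renormCurve M θ b) γ a x)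
      = kernel (renormCurve M θ) γ a := by
    funext x
    rw [kernel, kernel, ← mul_sub, mul_div_assoc', mul_div_mul_left _ _ hk]
  rw [e1] at h2
  convert h2 using 1
  rw [renormIntegral]
  field_simp

theorem deriv_renormCurve (M : ℝ) (hθ : Continuous θ) :
    deriv (renormCurve M θ) = renormDeriv M θ :=
  funext fun a => (hasDerivAt_renormCurve M hθ a).deriv

theorem birkhoffRott_mul_renormDeriv (hM : 0 < M) (hθ : ContDiff ℝ 2 θ) (hγ : ContDiff ℝ 1 γ)
    (hθper : Function.Periodic θ (2 * Real.pi)) (hγper : Function.Periodic γ (2 * Real.pi))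
    (hcos : 0 < mean (fun a => Real.cos (θ a)))
    (hinj : Function.Injective (renormCurve M θ)) (a : ℝ) :
    birkhoffRott (renormCurve M θ) γ a * renormDeriv M θ a
      = ((1 / (2 * Real.pi) : ℝ) : ℂ) * (Complex.I * renormIntegral M θ γ a) := by
  have hne := renormDeriv_ne_zero hM hθ.continuous hcos a
  have hpi : (Real.pi : ℂ) ≠ 0 := by exact_mod_cast Real.pi_ne_zero
  rw [birkhoffRott, (hasPV_kernel_renormCurve hM hθ hγ hθper hγper hcos hinj a).pv_eq]
  push_cast
  field_simp
  rw [Complex.I_sq]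
  ring

/-- On solutions of the kinematic equation the mean slope vanishes: the normal velocity of the
sheet has no flux through one period. -/
theorem mean_sin_eq_zero_of_normal (hM : 0 < M) (hθ : ContDiff ℝ 2 θ) (hγ : ContDiff ℝ 1 γ)
    (hθper : Function.Periodic θ (2 * Real.pi)) (hγper : Function.Periodic γ (2 * Real.pi))
    (hcos : 0 < mean (fun a => Real.cos (θ a)))
    (hinj : Function.Injective (renormCurve M θ)) {c : ℝ} (hc : c ≠ 0)
    (h₁ : ∀ a : ℝ, (birkhoffRott (renormCurve M θ) γ a * unitNormal (renormCurve M θ) a).re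
        + c * Real.sin (θ a) = 0) :
    mean (fun a => Real.sin (θ a)) = 0 := by
  refine mean_sin_eq_zero hθ.continuous hcos ?_
  have hflux := (isPeriodicCurve_renormCurve hM hθ hθper hcos hinj).integral_re_integral_symmKernel
    hγ hγper
  have hσ := renormScale_pos hM hcos
  have hpi := Real.pi_pos
  have hre : ∀ a, (renormIntegral M θ γ a).re = 2 * Real.pi * renormScale M θ * c *
      (Real.sin (θ a) * ‖Complex.exp (Complex.I * (θ a : ℂ))
      - Complex.I * (mean (fun b => Real.sin (θ b)) : ℂ)‖) := fun a => by
    have hB := birkhoffRott_mul_renormDeriv hM hθ hγ hθper hγper hcos hinj a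
    have hn : ‖renormDeriv M θ a‖ = renormScale M θ * ‖Complex.exp (Complex.I * (θ a : ℂ))
      - Complex.I * (mean (fun b => Real.sin (θ b)) : ℂ)‖ := by
      rw [renormDeriv, norm_mul, Complex.norm_real, Real.norm_of_nonneg hσ.le]
    have hn0 : ‖renormDeriv M θ a‖ ≠ 0 :=
      norm_ne_zero_iff.2 (renormDeriv_ne_zero hM hθ.continuous hcos a)
    have e : birkhoffRott (renormCurve M θ) γ a * unitNormal (renormCurve M θ) a
        = ((-(1 / (2 * Real.pi * ‖renormDeriv M θ a‖)) : ℝ) : ℂ) * renormIntegral M θ γ a := by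
      rw [unitNormal, unitTangent, deriv_renormCurve M hθ.continuous]
      have : birkhoffRott (renormCurve M θ) γ a *
          (Complex.I * (renormDeriv M θ a / (‖renormDeriv M θ a‖ : ℂ)))
          = birkhoffRott (renormCurve M θ) γ a * renormDeriv M θ a *
            (Complex.I / (‖renormDeriv M θ a‖ : ℂ)) := by ring
      have hn0' : (‖renormDeriv M θ a‖ : ℂ) ≠ 0 := by exact_mod_cast hn0
      have hpi' : (Real.pi : ℂ) ≠ 0 := by exact_mod_cast hpi.ne'
      rw [this, hB]
      push_cast
      field_simp
      rw [Complex.I_sq]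
      ring
    have h := h₁ a
    rw [e, Complex.re_ofReal_mul] at h
    rw [show 2 * Real.pi * renormScale M θ * c * (Real.sin (θ a)
      * ‖Complex.exp (Complex.I * (θ a : ℂ)) - Complex.I * (mean (fun b => Real.sin (θ b)) : ℂ)‖)
      = 2 * Real.pi * ‖renormDeriv M θ a‖ * (c * Real.sin (θ a)) by rw [hn]; ring]
    field_simp at h
    linarith
  change ∫ a in (0 : ℝ)..(2 * Real.pi), (renormIntegral M θ γ a).re = 0 at hflux
  simp_rw [hre] at hflux
  rw [intervalIntegral.integral_const_mul] at hflux
  exact (mul_eq_zero.1 hflux).resolve_left (by positivity)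

/-- The tangential component of the Birkhoff-Rott integral, for a sheet without mean slope. -/
def tangentialVelocity (M : ℝ) (θ γ : ℝ → ℝ) (a : ℝ) : ℝ :=
  -(1 / (2 * Real.pi * renormScale M θ)) * (renormIntegral M θ γ a).im

theorem differentiable_tangentialVelocity (hM : 0 < M) (hθ : ContDiff ℝ 2 θ)
    (hγ : ContDiff ℝ 1 γ) (hθper : Function.Periodic θ (2 * Real.pi))
    (hγper : Function.Periodic γ (2 * Real.pi)) (hcos : 0 < mean (fun a => Real.cos (θ a)))
    (hinj : Function.Injective (renormCurve M θ)) :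
    Differentiable ℝ (tangentialVelocity M θ γ) :=
  ((isPeriodicCurve_renormCurve hM hθ hθper hcos hinj).differentiable_im_integral_symmKernel
    hγ hγper).const_mul _

theorem renormDeriv_of_mean_sin (hs : mean (fun a => Real.sin (θ a)) = 0) (a : ℝ) :
    renormDeriv M θ a = renormScale M θ * Complex.exp (Complex.I * (θ a : ℂ)) := by
  rw [renormDeriv, hs]; simp

theorem norm_deriv_renormCurve (hM : 0 < M) (hθ : Continuous θ)
    (hcos : 0 < mean (fun a => Real.cos (θ a))) (hs : mean (fun a => Real.sin (θ a)) = 0)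
    (a : ℝ) : ‖deriv (renormCurve M θ) a‖ = renormScale M θ := by
  rw [deriv_renormCurve M hθ, renormDeriv_of_mean_sin hs, norm_mul, norm_exp_I_mul, mul_one,
    Complex.norm_real, Real.norm_of_nonneg (renormScale_pos hM hcos).le]

theorem unitTangent_renormCurve (hM : 0 < M) (hθ : Continuous θ)
    (hcos : 0 < mean (fun a => Real.cos (θ a))) (hs : mean (fun a => Real.sin (θ a)) = 0)
    (a : ℝ) : unitTangent (renormCurve M θ) a = Complex.exp (Complex.I * (θ a : ℂ)) := by
  have : (renormScale M θ : ℂ) ≠ 0 := by exact_mod_cast (renormScale_pos hM hcos).ne'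
  rw [unitTangent, norm_deriv_renormCurve hM hθ hcos hs, deriv_renormCurve M hθ,
    renormDeriv_of_mean_sin hs, mul_div_cancel_left₀ _ this]

/-- The kinematic equation prescribes the normal component of the Birkhoff-Rott integral, which
leaves only the tangential one to be differentiated. -/
theorem birkhoffRott_mul_exp (hM : 0 < M) (hθ : ContDiff ℝ 2 θ) (hγ : ContDiff ℝ 1 γ)
    (hθper : Function.Periodic θ (2 * Real.pi)) (hγper : Function.Periodic γ (2 * Real.pi))
    (hcos : 0 < mean (fun a => Real.cos (θ a)))
    (hinj : Function.Injective (renormCurve M θ)) (hs : mean (fun a => Real.sin (θ a)) = 0)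
    {c : ℝ} (h₁ : ∀ a : ℝ, (birkhoffRott (renormCurve M θ) γ a
      * unitNormal (renormCurve M θ) a).re + c * Real.sin (θ a) = 0) (a : ℝ) :
    birkhoffRott (renormCurve M θ) γ a * Complex.exp (Complex.I * (θ a : ℂ))
      = tangentialVelocity M θ γ a + Complex.I * (c * Real.sin (θ a) : ℝ) := by
  have hB := birkhoffRott_mul_renormDeriv hM hθ hγ hθper hγper hcos hinj a
  rw [renormDeriv_of_mean_sin hs] at hB
  have hσ := renormScale_pos hM hcos
  have hσ' : (renormScale M θ : ℂ) ≠ 0 := by exact_mod_cast hσ.ne'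
  have hpi' : (Real.pi : ℂ) ≠ 0 := by exact_mod_cast Real.pi_ne_zero
  have e : birkhoffRott (renormCurve M θ) γ a * Complex.exp (Complex.I * (θ a : ℂ))
      = ((1 / (2 * Real.pi * renormScale M θ) : ℝ) : ℂ)
        * (Complex.I * renormIntegral M θ γ a) := by
    have h2 : birkhoffRott (renormCurve M θ) γ a * Complex.exp (Complex.I * (θ a : ℂ))
        = birkhoffRott (renormCurve M θ) γ a
          * (renormScale M θ * Complex.exp (Complex.I * (θ a : ℂ))) / renormScale M θ := by
      field_simp
    rw [h2, hB]
    push_cast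
    field_simp
  have h := h₁ a
  rw [unitNormal, unitTangent_renormCurve hM hθ.continuous hcos hs, mul_left_comm,
    Complex.I_mul_re] at h
  apply Complex.ext
  · rw [e, Complex.re_ofReal_mul, Complex.I_mul_re, tangentialVelocity]
    simp
  · have : (birkhoffRott (renormCurve M θ) γ a * Complex.exp (Complex.I * (θ a : ℂ))).im
        = c * Real.sin (θ a) := by linarith
    rw [this]
    simp only [Complex.add_im, Complex.ofReal_im, Complex.I_mul_im, Complex.ofReal_re, zero_add]

end

/-! ### The traveling wave -/

section

variable {M : ℝ} {θ γ : ℝ → ℝ}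

/-- The limit of the velocity integrals of the renormalized curve at the point `u`. -/
def renormVelocity (M : ℝ) (θ γ : ℝ → ℝ) (u : ℂ) : ℂ :=
  ((Real.pi / M : ℝ) : ℂ) * ∫ x in (0 : ℝ)..Real.pi,
    (γ x * Complex.cot (((Real.pi / M : ℝ) : ℂ) * u - ((Real.pi / M : ℝ) : ℂ) * renormCurve M θ x)
      + γ (-x) * Complex.cot (((Real.pi / M : ℝ) : ℂ) * u
        - ((Real.pi / M : ℝ) : ℂ) * renormCurve M θ (-x)))

theorem renormVelocity_add_period (hM : 0 < M) (u : ℂ) :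
    renormVelocity M θ γ (u + M) = renormVelocity M θ γ u := by
  have hM' : (M : ℂ) ≠ 0 := by exact_mod_cast hM.ne'
  have e : ∀ v : ℂ, ((Real.pi / M : ℝ) : ℂ) * (u + M) - v
      = ((Real.pi / M : ℝ) : ℂ) * u - v + Real.pi := fun v => by
    push_cast; field_simp; ring
  simp only [renormVelocity, e, cot_add_pi]

theorem tendsto_velocityIntegral (hM : 0 < M) (hθ : ContDiff ℝ 2 θ) (hγ : ContDiff ℝ 1 γ)
    (hθper : Function.Periodic θ (2 * Real.pi)) (hγper : Function.Periodic γ (2 * Real.pi))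
    (hcos : 0 < mean (fun a => Real.cos (θ a)))
    (hinj : Function.Injective (renormCurve M θ)) (k : ℂ) (t : ℝ) {u : ℂ}
    (hu : ∀ a, renormCurve M θ a + k ≠ u) :
    Tendsto (velocityIntegral (fun a _ => renormCurve M θ a + k) (fun a _ => γ a) u t) atTop
      (𝓝 (renormVelocity M θ γ (u - k))) := by
  have hk : ((Real.pi / M : ℝ) : ℂ) ≠ 0 := by
    exact_mod_cast (div_pos Real.pi_pos hM).ne'
  have h := (isPeriodicCurve_renormCurve hM hθ hθper hcos hinj).tendsto_velocity hγ.continuous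
    hγper (u := ((Real.pi / M : ℝ) : ℂ) * (u - k))
    fun y hy => hu y (by rw [mul_left_cancel₀ hk hy]; ring)
  refine (h.const_mul ((Real.pi / M : ℝ) : ℂ)).congr fun R => ?_
  rw [velocityIntegral, ← intervalIntegral.integral_const_mul]
  congr 1
  funext x
  rw [← mul_sub, mul_div_assoc', mul_div_mul_left _ _ hk, sub_sub, add_comm k]

theorem velocity_renormCurve (hM : 0 < M) (hθ : ContDiff ℝ 2 θ) (hγ : ContDiff ℝ 1 γ)
    (hθper : Function.Periodic θ (2 * Real.pi)) (hγper : Function.Periodic γ (2 * Real.pi))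
    (hcos : 0 < mean (fun a => Real.cos (θ a)))
    (hinj : Function.Injective (renormCurve M θ)) (c t : ℝ) {u : ℂ}
    (hu : ∀ a, renormCurve M θ a + ((c * t : ℝ) : ℂ) ≠ u) :
    velocity (fun a t => renormCurve M θ a + ((c * t : ℝ) : ℂ)) (fun a _ => γ a) u t
      = (starRingEnd ℂ) ((1 / (2 * (Real.pi : ℂ) * Complex.I)) *
        renormVelocity M θ γ (u - ((c * t : ℝ) : ℂ))) := by
  have h := tendsto_velocityIntegral hM hθ hγ hθper hγper hcos hinj ((c * t : ℝ) : ℂ) t hu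
  rw [velocity]
  congr 2
  exact Tendsto.limUnder_eq h

/-- Let `B` be the conjugate velocity on a curve with tangent angle `θ`, `p` its tangential
component and `-c sin θ` its normal component. Then `X' = -Re (B_α T)`: the relative tangential velocity
`X = c cos θ - p` loses all terms with `θ_α`. -/
theorem differentiable_and_hasDerivAt_of_mul_exp_eq {B : ℝ → ℂ} {p : ℝ → ℝ} {c : ℝ}
    (hθ : Differentiable ℝ θ) (hp : Differentiable ℝ p)
    (hB : ∀ a, B a * Complex.exp (Complex.I * (θ a : ℂ))
      = p a + Complex.I * (c * Real.sin (θ a) : ℝ)) :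
    Differentiable ℝ B ∧ ∀ a, HasDerivAt (fun b => c * Real.cos (θ b) - p b)
      (-(deriv B a * Complex.exp (Complex.I * (θ a : ℂ))).re) a := by
  have hd : ∀ a, HasDerivAt θ (deriv θ a) a := fun a => (hθ a).hasDerivAt
  have hdp : ∀ a, HasDerivAt p (deriv p a) a := fun a => (hp a).hasDerivAt
  have hexp : ∀ a, HasDerivAt (fun b => Complex.exp (Complex.I * (θ b : ℂ)))
      (Complex.exp (Complex.I * (θ a : ℂ)) * (Complex.I * ((deriv θ a : ℝ) : ℂ))) a := fun a =>
    ((hd a).ofReal_comp.const_mul Complex.I).cexp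
  have hBe : B = fun a => (p a + Complex.I * ((c * Real.sin (θ a) : ℝ) : ℂ))
      / Complex.exp (Complex.I * (θ a : ℂ)) := by
    funext a
    rw [← hB a, mul_div_cancel_right₀ _ (Complex.exp_ne_zero _)]
  have hnum : ∀ a, HasDerivAt (fun b => (p b : ℂ) + Complex.I * ((c * Real.sin (θ b) : ℝ) : ℂ))
      (((deriv p a : ℝ) : ℂ) + Complex.I * ((c * (Real.cos (θ a) * deriv θ a) : ℝ) : ℂ)) a :=
    fun a => (hdp a).ofReal_comp.add (((hd a).sin.const_mul c).ofReal_comp.const_mul Complex.I)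
  have hBd : Differentiable ℝ B := fun a => by
    rw [hBe]
    exact ((hnum a).div (hexp a) (Complex.exp_ne_zero _)).differentiableAt
  refine ⟨hBd, fun a => ?_⟩
  have hprod := (hBd a).hasDerivAt.mul (hexp a)
  have heq : B * (fun b => Complex.exp (Complex.I * (θ b : ℂ)))
      = fun b => (p b : ℂ) + Complex.I * ((c * Real.sin (θ b) : ℝ) : ℂ) := funext hB
  rw [heq] at hprod
  have huniq := hprod.unique (hnum a)
  rw [← mul_assoc, hB a] at huniq
  have hre := congrArg Complex.re huniq
  simp only [Complex.add_re, Complex.mul_re, Complex.add_im, Complex.mul_im, Complex.ofReal_re,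
    Complex.ofReal_im, Complex.I_re, Complex.I_im] at hre
  refine (((hd a).cos.const_mul c).sub (hdp a)).congr_deriv ?_
  rw [Complex.mul_re]
  linarith

/-- Multiplication by `τ / σ` turns the renormalized dynamic equation, with `X' = -Re (W_α T)`,
into the equation for the sheet-strength. -/
theorem strength_equation_of_renormalized {τ A g M q m σ D₁ D₂ S X X' Θ : ℝ} (hτ : τ ≠ 0)
    (hq : q ≠ 0) (hm : m ≠ 0) (hσ : σ ≠ 0) (hM : M = 2 * q * m * σ)
    (h : Θ + (1 / τ * D₁ - A / τ * (q * m / (2 * M) * D₂ + g * M ^ 2 / (2 * q ^ 2 * m ^ 2) * S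
      + M / (2 * q * m) * (2 * X * X'))) = 0) :
    0 = τ * Θ / σ + D₁ / σ
      - 2 * A * (0 / σ + 1 / 8 * (D₂ / σ ^ 2) + g * (σ * S) - X * -X') := by
  subst hM
  have e : τ * Θ / σ + D₁ / σ - 2 * A * (0 / σ + 1 / 8 * (D₂ / σ ^ 2) + g * (σ * S) - X * -X')
      = τ / σ * (Θ + (1 / τ * D₁ - A / τ * (q * m / (2 * (2 * q * m * σ)) * D₂
        + g * (2 * q * m * σ) ^ 2 / (2 * q ^ 2 * m ^ 2) * S
        + 2 * q * m * σ / (2 * q * m) * (2 * X * X')))) := by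
    field_simp
    ring
  rw [e, h, mul_zero]

end

end VortexSheet

end

theorem mainTheorem6
    (ρ₁ ρ₂ τ g M : ℝ) (hρ₁ : 0 ≤ ρ₁) (hρ₂ : 0 ≤ ρ₂) (hρ : 0 < ρ₁ + ρ₂)
    (hτ : 0 < τ) (hM : 0 < M)
    (θ γ : ℝ → ℝ) (c : ℝ) (hc : c ≠ 0)
    (hθ : ContDiff ℝ 2 θ) (hγ : ContDiff ℝ 1 γ)
    (hθper : Function.Periodic θ (2 * Real.pi)) (hγper : Function.Periodic γ (2 * Real.pi))
    (hcos : 0 < VortexSheet.mean (fun a => Real.cos (θ a)))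
    (hinj : Function.Injective (VortexSheet.renormCurve M θ))
    (h₁ : ∀ a : ℝ,
      (VortexSheet.birkhoffRott (VortexSheet.renormCurve M θ) γ a
          * VortexSheet.unitNormal (VortexSheet.renormCurve M θ) a).re
        + c * Real.sin (θ a) = 0)
    (h₂ : ∀ a : ℝ,
      deriv (deriv θ) a
        + VortexSheet.phiTilde τ (VortexSheet.atwood ρ₁ ρ₂) g M θ γ c a = 0) :
    VortexSheet.IsTravelingWave τ (VortexSheet.atwood ρ₁ ρ₂) g c
        (fun a t => VortexSheet.renormCurve M θ a + ((c * t : ℝ) : ℂ)) (fun a _ => γ a) ∧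
      VortexSheet.IsSpatiallyPeriodic M
        (fun a t => VortexSheet.renormCurve M θ a + ((c * t : ℝ) : ℂ)) (fun a _ => γ a) := by
  open VortexSheet in
  have hθc := hθ.continuous
  have hs := mean_sin_eq_zero_of_normal hM hθ hγ hθper hγper hcos hinj hc h₁
  have hσ := renormScale_pos hM hcos
  have hBT := birkhoffRott_mul_exp hM hθ hγ hθper hγper hcos hinj hs h₁
  have hpd := differentiable_tangentialVelocity hM hθ hγ hθper hγper hcos hinj
  have hθd := hθ.differentiable two_ne_zero
  obtain ⟨hBd, hX⟩ := differentiable_and_hasDerivAt_of_mul_exp_eq hθd hpd hBT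
  have hT := unitTangent_renormCurve hM hθc hcos hs
  have hn := norm_deriv_renormCurve hM hθc hcos hs
  have hW : ∀ a t, Wstar (fun a t => renormCurve M θ a + ((c * t : ℝ) : ℂ)) (fun a _ => γ a) a t
      = birkhoffRott (renormCurve M θ) γ a := fun a t => birkhoffRott_add_const _ _ _ _
  have hZd : ∀ t a, deriv (fun b => renormCurve M θ b + ((c * t : ℝ) : ℂ)) a
      = deriv (renormCurve M θ) a := fun t a => deriv_add_const _
  have hrel : relativeTangential M θ γ c
      = fun a => c * Real.cos (θ a) - tangentialVelocity M θ γ a := by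
    funext a
    rw [relativeTangential, hT, hBT]
    simp
  have hXW : ∀ a, deriv (relativeTangential M θ γ c) a
      = -(deriv (birkhoffRott (renormCurve M θ) γ) a * unitTangent (renormCurve M θ) a).re :=
    fun a => by rw [hrel, hT]; exact (hX a).deriv
  have hXd : Differentiable ℝ (relativeTangential M θ γ c) := by
    rw [hrel]; exact fun a => (hX a).differentiableAt
  have hoff : ∀ t u, u ∉ interface (fun a t => renormCurve M θ a + ((c * t : ℝ) : ℂ)) t →
      ∀ a, renormCurve M θ a + ((c * t : ℝ) : ℂ) ≠ u := fun t u hu a ha => hu ⟨a, ha⟩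
  refine ⟨⟨⟨fun a _ => θ a, fun a _ => c * Real.cos (θ a), ?_⟩, ?_, ?_⟩, ?_, ?_⟩
  · constructor
    case z_space =>
      refine fun t => ContDiff.add ?_ contDiff_const
      rw [contDiff_one_iff_deriv, deriv_renormCurve M hθc]
      exact ⟨fun a => (hasDerivAt_renormCurve M hθc a).differentiableAt,
        by unfold renormDeriv; fun_prop⟩
    case z_time =>
      intro a t
      exact (((hasDerivAt_id t).const_mul c).ofReal_comp.const_add _).differentiableAt
    case z_regular =>
      intro a t
      rw [hZd, deriv_renormCurve M hθc]
      exact renormDeriv_ne_zero hM hθc hcos a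
    case z_injective => exact fun t a b hab => hinj (add_right_cancel hab)
    case γ_space => exact fun _ => hγ
    case γ_time => exact fun _ => differentiable_const _
    case θ_space => exact fun _ => hθ
    case V_space => exact fun _ => by fun_prop
    case W_exists =>
      intro a t
      rw [kernel_add_const]
      exact ⟨_, hasPV_kernel_renormCurve hM hθ hγ hθper hγper hcos hinj a⟩
    case W_space =>
      intro t
      simp_rw [hW]
      exact hBd
    case W_time =>
      intro a
      simp_rw [hW]
      exact differentiable_const _
    case u_exists =>
      intro t u hu
      exact ⟨_, tendsto_velocityIntegral hM hθ hγ hθper hγper hcos hinj _ t (hoff t u hu)⟩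
    case tangent_angle =>
      intro a t
      rw [hZd, hn, deriv_renormCurve M hθc, renormDeriv_of_mean_sin hs]
    case z_eqn =>
      intro a t
      have h := h₁ a
      have hd : HasDerivAt (fun s : ℝ => renormCurve M θ a + ((c * s : ℝ) : ℂ)) (c : ℂ) t := by
        have := (((hasDerivAt_id t).const_mul c).ofReal_comp.const_add (renormCurve M θ a))
        simpa using this
      have hU : (birkhoffRott (renormCurve M θ) γ a * unitNormal (renormCurve M θ) a).re
          = -(c * Real.sin (θ a)) := by linarith
      simp only [hW, unitNormal, unitTangent_add_const]
      rw [← unitNormal, hU, unitNormal, hT, hd.deriv, exp_I_mul]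
      -- `c = -c sin θ · i e^{iθ} + c cos θ · e^{iθ}`
      have h3 : (Real.sin (θ a) : ℂ) ^ 2 + (Real.cos (θ a) : ℂ) ^ 2 = 1 := by
        exact_mod_cast Real.sin_sq_add_cos_sq (θ a)
      push_cast at h3 ⊢
      linear_combination (-(c : ℂ)) * h3 + c * Complex.sin (θ a) ^ 2 * Complex.I_sq
    case γ_eqn =>
      intro a t
      have h := h₂ a
      have him : deriv (fun b => (renormCurve M θ b + ((c * t : ℝ) : ℂ)).im) a
          = renormScale M θ * Real.sin (θ a) := by
        have hd := Complex.imCLM.hasFDerivAt.comp_hasDerivAt a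
          ((hasDerivAt_renormCurve M hθc a).add_const ((c * t : ℝ) : ℂ))
        refine hd.deriv.trans ?_
        rw [renormDeriv_of_mean_sin hs, exp_I_mul]
        simp [-Complex.ofReal_sin, -Complex.ofReal_cos]
      have hsq : deriv (fun b => relativeTangential M θ γ c b ^ 2) a
          = 2 * relativeTangential M θ γ c a * deriv (relativeTangential M θ γ c) a := by
        have := ((hXd a).hasDerivAt.fun_pow 2).deriv
        simpa using this
      have hrel' : ∀ b, c * Real.cos (θ b) - (birkhoffRott (renormCurve M θ) γ b
        * unitTangent (renormCurve M θ) b).re = relativeTangential M θ γ c b := fun b => rfl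
      simp only [hW, unitTangent_add_const, hZd, hn, deriv_const, him, hrel', zero_mul,
        Complex.zero_re]
      rw [← neg_neg (deriv (birkhoffRott _ _) a * _).re, ← hXW]
      simp only [phiTilde, hsq, hs, sub_zero] at h
      have hMσ : M = 2 * Real.pi * mean (fun b => Real.cos (θ b)) * renormScale M θ := by
        have := Real.pi_ne_zero
        rw [renormScale]; field_simp
      exact strength_equation_of_renormalized hτ.ne' Real.pi_ne_zero hcos.ne' hσ.ne' hMσ h
  · intro t
    ext u
    simp only [interface, Set.mem_range, Set.mem_ofPred_eq, mul_zero, Complex.ofReal_zero, add_zero,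
      eq_sub_iff_add_eq]
  · intro t u hu
    rw [velocity_renormCurve hM hθ hγ hθper hγper hcos hinj c t (hoff t u hu),
      velocity_renormCurve hM hθ hγ hθper hγper hcos hinj c 0, mul_zero, Complex.ofReal_zero,
      sub_zero]
    intro a ha
    rw [mul_zero, Complex.ofReal_zero, add_zero] at ha
    exact hoff t u hu a (by rw [ha]; ring)
  · intro t
    ext u
    simp only [interface, Set.mem_range, Set.mem_ofPred_eq]
    constructor
    · rintro ⟨a, rfl⟩
      refine ⟨a - 2 * Real.pi, ?_⟩
      have := renormCurve_translate M hθc hθper hcos (a - 2 * Real.pi)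
      rw [sub_add_cancel] at this
      rw [this]; ring
    · rintro ⟨a, ha⟩
      refine ⟨a + 2 * Real.pi, ?_⟩
      rw [renormCurve_translate M hθc hθper hcos, add_right_comm, ha]; ring
  · intro t u hu
    rw [velocity_renormCurve hM hθ hγ hθper hγper hcos hinj c t (hoff t u hu),
      velocity_renormCurve hM hθ hγ hθper hγper hcos hinj c t, add_sub_right_comm,
      renormVelocity_add_period hM]
    intro a ha
    refine hoff t u hu (a - 2 * Real.pi) ?_
    have := renormCurve_translate M hθc hθper hcos (a - 2 * Real.pi)
    rw [sub_add_cancel] at this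
    rw [this] at ha
    linear_combination ha
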